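/- **Sampling model.** Let $\mu$ be a probability distribution on $\mathbb{R}$ with distribution function $F$ and median $g(F)=F^{-1}(1/2)=\inf\{x: F(x)\ge 1/2\}$. Let $X_0,X_1,\dots$ be i.i.d. unobserved points with law $\mu$, and let $Z_0,Z_1,\dots$ be i.i.d. $\mathcal N(0,1)$, independent of the points. An online (adaptive, possibly randomized) algorithm proceeds in steps $i=0,1,2,\dots$: based on its internal randomness (independent of all $X_j,Z_j$) and on everything observed so far, it either stops and outputs an estimate $\hat G$ of $g(F)$, or chooses an index $a_i\in\mathbb{N}$ (a point queried before, or a new one) and observes $Y_i=X_{a_i}+Z_i$. Let $M\in\mathbb{N}\cup\{\infty\}$ be the number of observations made; an algorithm with a fixed budget $t$ has $M=t$. The algorithm is $(\epsilon,\delta)$-PAC at $\mu$ if, with probability at least $1-\delta$, it stops and $|\hat G-g(F)|\le\epsilon$. **Class of distributions.** Write $f\lesssim h$ if for every $c>0$, $f(\epsilon)=O(\epsilon^{-c}h(\epsilon))$ as $\epsilon\to0^+$. Fix $c_1,c_2>0$ and positive functions $r_1,r_2$ of $\epsilon>0$ with $r_1(\epsilon)\lesssim\epsilon$ and $r_2(\epsilon)\lesssim\sqrt{\epsilon}$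 (for example $r_1(\epsilon)=A\epsilon$ and $r_2(\epsilon)=B\sqrt\epsilon$ with constants $A,B>0$). Let $\mathcal F_\epsilon$ be the set of probability distributions on $\mathbb{R}$ whose distribution function $F$ satisfies - $F$ is differentiable at $x$ with $F'(x)\ge c_1$ whenever $|x-g(F)|\le r_1(\epsilon)$; - $F$ is twice differentiable at $x$ with $|F''(x)|\le c_2$ whenever $|x-g(F)|\le r_2(\epsilon)$. **Theorem.** For every $\theta>0$ and all $c_1,c_2,r_1,r_2$ as above there are constants $C>0$ and $\epsilon_0>0$, depending only on $\theta,c_1,c_2,r_1,r_2$, such that for every $\epsilon\in(0,\epsilon_0)$: if an online algorithm is $(\epsilon,0.1)$-PAC at every $\mu\in\mathcal F_\epsilon$, then there is a $\mu\in\mathcal F_\epsilon$ under which its expected number of samples satisfies $$\mathbb{E}_\mu[M]\ \ge\ C\,\epsilon^{-5/2+\theta}.$$ In particular, an algorithm with fixed budget $t$ that is $(\epsilon,0.1)$-PAC on $\mathcal F_\epsilon$ has $t\ge C\epsilon^{-5/2+\theta}$. -/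

import Mathlib

open Filter Topology MeasureTheory ProbabilityTheory

open scoped ENNReal Asymptotics

/-- The median `F⁻¹(1/2) = inf {x | F(x) ≥ 1/2}`, where `F` is the distribution function
of the law `μ`. -/
noncomputable def median (μ : ProbabilityMeasure ℝ) : ℝ :=
  sInf {x : ℝ | 1 / 2 ≤ cdf (μ : Measure ℝ) x}

/-- `f ≲ g` as the argument tends to `0` from the right: `f = O(g)` up to constants, logarithmic
factors and factors `ε ^ (-c)` with `c > 0` arbitrarily close to zero. -/
def LessApprox (f g : ℝ → ℝ) : Prop :=
  ∀ c : ℝ, 0 < c → f =O[𝓝[>] 0] fun ε => ε ^ (-c) * g ε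

/-- The laws whose distribution function `F` satisfies `F' ≥ c₁` within distance `r₁` of the
median, and is twice differentiable with `|F''| ≤ c₂` within distance `r₂` of the median. -/
def medianClass (c₁ c₂ r₁ r₂ : ℝ) : Set (ProbabilityMeasure ℝ) :=
  {μ | (∀ x : ℝ, |x - median μ| ≤ r₁ →
          DifferentiableAt ℝ (cdf (μ : Measure ℝ)) x ∧ c₁ ≤ deriv (cdf (μ : Measure ℝ)) x) ∧
       (∀ x : ℝ, |x - median μ| ≤ r₂ →
          (∀ᶠ y in 𝓝 x, DifferentiableAt ℝ (cdf (μ : Measure ℝ)) y) ∧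
          DifferentiableAt ℝ (deriv (cdf (μ : Measure ℝ))) x ∧
          |deriv (deriv (cdf (μ : Measure ℝ))) x| ≤ c₂)}

/-- An online algorithm with internal randomness (a seed with values in `S`).
After `n` observations it sees the seed and the `n` observed values (hence also the points it has
queried so far, which are functions of these), and it decides whether to stop.
If it does not stop, it queries the point with index `arm n _`, which may be a point
queried before or a new one; if it stops, it outputs `estimate n _`. -/
structure OnlineAlgorithm (S : Type*) [MeasurableSpace S] where
  seedLaw : Measure S
  isProbabilityMeasure_seedLaw : IsProbabilityMeasure seedLaw
  arm : (n : ℕ) → S × (Fin n → ℝ) → ℕ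
  measurable_arm : ∀ n, Measurable (arm n)
  halt : (n : ℕ) → Set (S × (Fin n → ℝ))
  measurableSet_halt : ∀ n, MeasurableSet (halt n)
  estimate : (n : ℕ) → S × (Fin n → ℝ) → ℝ
  measurable_estimate : ∀ n, Measurable (estimate n)

namespace OnlineAlgorithm

variable {S : Type*} [MeasurableSpace S]

/-- The joint law of the seed, the latent points `X₀, X₁, …` (i.i.d. with law `μ`) and the noise
variables `Z₀, Z₁, …` (i.i.d. standard Gaussian), all independent. -/
noncomputable def law (π : OnlineAlgorithm S) (μ : ProbabilityMeasure ℝ) :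
    Measure (S × (ℕ → ℝ) × (ℕ → ℝ)) :=
  π.seedLaw.prod
    ((Measure.infinitePi fun _ : ℕ => (μ : Measure ℝ)).prod
      (Measure.infinitePi fun _ : ℕ => gaussianReal 0 1))

/-- The first `n` observations (ignoring the stopping rule) when the seed is `ω.1`, the latent
points are `ω.2.1` and the noise variables are `ω.2.2`: observation number `n` is
`X (arm chosen from the past) + Z n`. -/
noncomputable def obs (π : OnlineAlgorithm S) (ω : S × (ℕ → ℝ) × (ℕ → ℝ)) :
    (n : ℕ) → Fin n → ℝ
  | 0 => Fin.elim0
  | n + 1 => Fin.snoc (α := fun _ => ℝ) (π.obs ω n)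
      (ω.2.1 (π.arm n (ω.1, π.obs ω n)) + ω.2.2 n)

/-- The number of samples taken, i.e. the first time at which the algorithm stops
(`⊤` if it never stops). -/
noncomputable def numSamples (π : OnlineAlgorithm S) (ω : S × (ℕ → ℝ) × (ℕ → ℝ)) : ℕ∞ :=
  ⨅ (n : ℕ) (_ : (ω.1, π.obs ω n) ∈ π.halt n), (n : ℕ∞)

/-- The expected number of samples when the underlying law is `μ`. -/
noncomputable def expectedSamples (π : OnlineAlgorithm S) (μ : ProbabilityMeasure ℝ) : ℝ≥0∞ :=
  ∫⁻ ω, (π.numSamples ω : ℝ≥0∞) ∂(π.law μ)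

/-- The output is an `(ε, δ)`-PAC approximation of `g` when the underlying law is `μ`: the
probability that the algorithm errs by more than `ε` (or never stops) is at most `δ`. -/
def IsPAC (π : OnlineAlgorithm S) (μ : ProbabilityMeasure ℝ) (g ε δ : ℝ) : Prop :=
  π.law μ {ω | ¬ ∃ n : ℕ, π.numSamples ω = n ∧ |π.estimate n (ω.1, π.obs ω n) - g| ≤ ε} ≤
    ENNReal.ofReal δ

end OnlineAlgorithm

/-! Two-point method. Both laws have density `c` on `(-w, w]` and atoms at `±w`, `±3w`, so `F` is
affine on `(-w, w)` and the class conditions hold once `w` exceeds `r₁` and `r₂` by the margin `3ε`.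
The second law tilts the atoms by `δ` times a third finite difference. On `(-w, w)` this raises `F`
by `2qδ`, hence moves the median by `3ε` for some `δ` of order `ε`, but it leaves the moments of
order 0, 1, 2 unchanged.

Noise hides matched moments: the `χ²` cost of `k` observations of one point is governed by the sum
over `j` of `k^j / j!` times the squared difference of the `j`-th moments. That sum starts at `j =
3`, so the cost is `O(δ² (k w²)³)` for small `k w²`. However often a point is observed, its cost
stays `O(δ²)`, because masses change only by factors `1 ± δ`. Among `n` observations at most `n`
points occur, and at most `n / (m + 1)` of them more than `m` times. The total exponent is thus of
order `n ε² (m w²)³ + ε² n / m`, which is small for `w = ε^(7/16)`, `m ≈ ε^(-5/8)`, `n ≈ ε^(-5/2)`.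

Adaptivity: relative to i.i.d. `N(0, 1)`, the likelihood of the observations is a product over
queried points of functions of the count and the sum (`lintegral_lintegral_observations`,
`law_obs_mem`). Since the counts are chosen adaptively, a second moment at a fixed count does not
suffice. Instead the squared ratio of one point is dominated by a supermartingale (`tiltWeight`,
`sq_pointLR_le`), and products of such supermartingales survive any querying rule
(`lintegral_queryProd_le`). `law_obs_mem_le` converts this into closeness of the laws, and
`le_expectedSamples` into a bound on the expected number of samples. -/

/-! ### Gaussian shifts and product measures. -/

/-- The standard Gaussian measure on `Fin n → ℝ`. -/
noncomputable def stdGaussianPi (n : ℕ) : Measure (Fin n → ℝ) :=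
  Measure.pi fun _ => gaussianReal 0 1

instance isProbabilityMeasure_stdGaussianPi (n : ℕ) :
    IsProbabilityMeasure (stdGaussianPi n) := by
  unfold stdGaussianPi; infer_instance

/-- The density of `N(x, 1)` with respect to `N(0, 1)`. -/
noncomputable def gaussianLR (x y : ℝ) : ℝ≥0∞ := ENNReal.ofReal (Real.exp (x * y - x ^ 2 / 2))

@[fun_prop]
theorem measurable_gaussianLR {α : Type*} [MeasurableSpace α] {f g : α → ℝ} (hf : Measurable f)
    (hg : Measurable g) : Measurable fun a => gaussianLR (f a) (g a) := by
  unfold gaussianLR; fun_prop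

theorem measurable_snoc (n : ℕ) :
    Measurable fun p : (Fin n → ℝ) × ℝ => (Fin.snoc (α := fun _ => ℝ) p.1 p.2 : Fin (n + 1) → ℝ) := by
  refine measurable_pi_lambda _ fun i => ?_
  refine Fin.lastCases ?_ (fun j => ?_) i
  · simpa using measurable_snd
  · simpa [Function.comp_def] using (measurable_pi_apply j).comp measurable_fst

theorem lintegral_stdGaussianPi_succ (n : ℕ) {G : (Fin (n + 1) → ℝ) → ℝ≥0∞} (hG : Measurable G) :
    ∫⁻ y, G y ∂stdGaussianPi (n + 1) =
      ∫⁻ y, ∫⁻ t, G (Fin.snoc (α := fun _ => ℝ) y t) ∂gaussianReal 0 1 ∂stdGaussianPi n := by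
  have h := (measurePreserving_piFinSuccAbove (fun _ : Fin (n + 1) => gaussianReal 0 1)
    (Fin.last n)).symm
  rw [stdGaussianPi, ← h.lintegral_comp_emb (MeasurableEquiv.measurableEmbedding _)]
  rw [lintegral_prod_symm (fun p => G ((MeasurableEquiv.piFinSuccAbove (fun _ => ℝ) (Fin.last n)).symm p))
    (hG.comp (MeasurableEquiv.measurable _)).aemeasurable]
  simp only [stdGaussianPi]
  refine lintegral_congr fun y => lintegral_congr fun t => ?_
  congr 1
  simp [MeasurableEquiv.piFinSuccAbove, Fin.insertNthEquiv]

theorem lintegral_gaussianReal_const_add (c : ℝ) {f : ℝ → ℝ≥0∞} (hf : Measurable f) :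
    ∫⁻ t, f (c + t) ∂gaussianReal 0 1 = ∫⁻ t, f t * gaussianLR c t ∂gaussianReal 0 1 := by
  have h : ∫⁻ t, f (c + t) ∂gaussianReal 0 1 = ∫⁻ t, f t ∂gaussianReal c 1 := by
    have := gaussianReal_map_const_add (μ := 0) (v := 1) c
    rw [zero_add] at this
    rw [← this, lintegral_map hf (by fun_prop)]
  rw [h, gaussianReal_of_var_ne_zero _ one_ne_zero, gaussianReal_of_var_ne_zero _ one_ne_zero,
    lintegral_withDensity_eq_lintegral_mul _ (measurable_gaussianPDF _ _) hf,
    lintegral_withDensity_eq_lintegral_mul _ (measurable_gaussianPDF _ _) (by fun_prop)]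
  refine lintegral_congr fun t => ?_
  simp only [Pi.mul_apply, gaussianPDF, gaussianLR, gaussianPDFReal]
  rw [mul_comm (f t), ← mul_assoc, ← ENNReal.ofReal_mul (by positivity),
    mul_assoc _ (Real.exp _) (Real.exp _), ← Real.exp_add]
  congr 4
  push_cast; ring

theorem map_infinitePi_gaussian_restrict (n : ℕ) :
    (Measure.infinitePi fun _ : ℕ => gaussianReal 0 1).map (fun z (i : Fin n) => z i) =
      stdGaussianPi n := by
  symm
  refine Measure.pi_eq fun s hs => ?_
  rw [Measure.map_apply (by fun_prop) (MeasurableSet.univ_pi hs)]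
  have := Measure.infinitePi_pi (fun _ : ℕ => gaussianReal 0 1) (s := Finset.range n)
    (t := fun i => if h : i < n then s ⟨i, h⟩ else Set.univ)
    (by intro i hi; split_ifs <;> simp [hs])
  rw [Finset.prod_range] at this
  simp only [Fin.is_lt, dite_true, Fin.eta] at this
  rw [← this]
  congr 1
  ext z
  simp only [Set.mem_preimage, Set.mem_pi, Set.mem_univ, true_implies, Finset.coe_range,
    Set.mem_Iio]
  constructor
  · intro h i hi; simpa [hi] using h ⟨i, hi⟩
  · intro h i; simpa using h i i.2

theorem lintegral_infinitePi_prod (μ : ProbabilityMeasure ℝ) (A : Finset ℕ)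
    {f : ℕ → ℝ → ℝ≥0∞} (hf : ∀ a, Measurable (f a)) :
    ∫⁻ x, ∏ a ∈ A, f a (x a) ∂(Measure.infinitePi fun _ : ℕ => (μ : Measure ℝ)) =
      ∏ a ∈ A, ∫⁻ x, f a x ∂(μ : Measure ℝ) := by
  have hind := iIndepFun_infinitePi (P := fun _ : ℕ => (μ : Measure ℝ)) (X := fun a => f a) hf
  rw [lintegral_prod_eq_prod_lintegral_of_indepFun A _ hind
    fun a => (hf a).comp (measurable_pi_apply a)]
  refine Finset.prod_congr rfl fun a _ => ?_
  exact (measurePreserving_eval_infinitePi (fun _ : ℕ => (μ : Measure ℝ)) a).lintegral_comp (hf a)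

/-! ### Likelihood of adaptive observations. -/

/-- The points queried along the observation sequence `y` under the querying rule `a`. -/
def queries (a : (n : ℕ) → (Fin n → ℝ) → ℕ) : (n : ℕ) → (Fin n → ℝ) → Fin n → ℕ
  | 0, _ => Fin.elim0
  | n + 1, y => Fin.snoc (α := fun _ => ℕ) (queries a n (Fin.init y)) (a n (Fin.init y))

/-- The observations produced by the querying rule `a`, the latent points `x` and the noise `z`. -/
def observations (a : (n : ℕ) → (Fin n → ℝ) → ℕ) (x : ℕ → ℝ) : (n : ℕ) → (Fin n → ℝ) → Fin n → ℝ
  | 0, _ => Fin.elim0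
  | n + 1, z => Fin.snoc (α := fun _ => ℝ) (observations a x n (Fin.init z))
      (x (a n (observations a x n (Fin.init z))) + z (Fin.last n))

/-- The number of queries of the point `b`. -/
def queryCount {n : ℕ} (α : Fin n → ℕ) (b : ℕ) : ℕ := ∑ i, if α i = b then 1 else 0

/-- The sum of the observations of the point `b`. -/
def querySum {n : ℕ} (α : Fin n → ℕ) (y : Fin n → ℝ) (b : ℕ) : ℝ := ∑ i, if α i = b then y i else 0

/-- The product over the queried points `b` of a function of the number and of the sum of the
observations of `b`. -/
noncomputable def queryProd (w : ℕ → ℝ → ℝ≥0∞) {n : ℕ} (α : Fin n → ℕ) (y : Fin n → ℝ) : ℝ≥0∞ :=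
  ∏ b ∈ Finset.univ.image α, w (queryCount α b) (querySum α y b)

/-- The likelihood ratio, with respect to i.i.d. `N(0, 1)`, of `k` observations with sum `s` of a
single point with law `μ`. -/
noncomputable def pointLR (μ : Measure ℝ) (k : ℕ) (s : ℝ) : ℝ≥0∞ :=
  ∫⁻ x, ENNReal.ofReal (Real.exp (x * s - k * x ^ 2 / 2)) ∂μ

@[fun_prop]
theorem measurable_querySum {n : ℕ} (α : Fin n → ℕ) (b : ℕ) :
    Measurable fun y : Fin n → ℝ => querySum α y b := by
  unfold querySum
  refine Finset.measurable_sum _ fun i _ => ?_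
  split_ifs <;> fun_prop

theorem measurable_init (n : ℕ) :
    Measurable fun y : Fin (n + 1) → ℝ => (Fin.init y : Fin n → ℝ) :=
  measurable_pi_lambda _ fun _ => measurable_pi_apply _

theorem measurable_queries {S : Type*} [MeasurableSpace S] {a : S → (n : ℕ) → (Fin n → ℝ) → ℕ}
    (ha : ∀ n, Measurable fun p : S × (Fin n → ℝ) => a p.1 n p.2) (n : ℕ) :
    Measurable fun p : S × (Fin n → ℝ) => queries (a p.1) n p.2 := by
  induction n with
  | zero => exact measurable_pi_lambda _ fun i => i.elim0
  | succ n ih =>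
    have h : Measurable fun p : S × (Fin (n + 1) → ℝ) => (p.1, (Fin.init p.2 : Fin n → ℝ)) :=
      measurable_fst.prodMk ((measurable_init n).comp measurable_snd)
    refine measurable_pi_lambda _ fun i => ?_
    refine Fin.lastCases ?_ (fun j => ?_) i
    · simpa [queries] using! (ha n).comp h
    · simpa [queries] using! (measurable_pi_apply j).comp (ih.comp h)

theorem measurable_observations {Ω : Type*} [MeasurableSpace Ω]
    {a : Ω → (n : ℕ) → (Fin n → ℝ) → ℕ} {x : Ω → ℕ → ℝ}
    (ha : ∀ n, Measurable fun p : Ω × (Fin n → ℝ) => a p.1 n p.2) (hx : Measurable x) (n : ℕ) :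
    Measurable fun p : Ω × (Fin n → ℝ) => observations (a p.1) (x p.1) n p.2 := by
  have hev : Measurable fun q : (ℕ → ℝ) × ℕ => q.1 q.2 :=
    measurable_from_prod_countable_left fun _ => by fun_prop
  induction n with
  | zero => exact measurable_pi_lambda _ fun i => i.elim0
  | succ n ih =>
    have h : Measurable fun p : Ω × (Fin (n + 1) → ℝ) => (p.1, (Fin.init p.2 : Fin n → ℝ)) :=
      measurable_fst.prodMk ((measurable_init n).comp measurable_snd)
    have h1 := ih.comp h
    have h2 := (ha n).comp (measurable_fst.prodMk h1)
    exact (measurable_snoc n).comp (h1.prodMk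
      ((hev.comp ((hx.comp measurable_fst).prodMk h2)).add
        ((measurable_pi_apply _).comp measurable_snd)))

theorem measurable_comp_queries {a : (n : ℕ) → (Fin n → ℝ) → ℕ} (ha : ∀ n, Measurable (a n))
    {n : ℕ} {Ω : Type*} [MeasurableSpace Ω] {y : Ω → Fin n → ℝ} (hy : Measurable y)
    {f : (Fin n → ℕ) → Ω → ℝ≥0∞} (hf : ∀ α, Measurable (f α)) :
    Measurable fun ω => f (queries a n (y ω)) ω := by
  have h : Measurable fun p : (Fin n → ℕ) × Ω => f p.1 p.2 :=
    measurable_from_prod_countable_right fun α => hf α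
  have hq : Measurable fun y : Fin n → ℝ => queries a n y :=
    (measurable_queries (S := Unit) (a := fun _ => a) (fun n => (ha n).comp measurable_snd) n).comp
      (measurable_const (a := ()) |>.prodMk measurable_id)
  exact h.comp ((hq.comp hy).prodMk measurable_id)

/-- Each index depends only on earlier observations, so the last noise variable can be shifted with
the past held fixed; induction on `n` does the rest. -/
theorem lintegral_observations {a : (n : ℕ) → (Fin n → ℝ) → ℕ} (ha : ∀ n, Measurable (a n))
    (x : ℕ → ℝ) (n : ℕ) {G : (Fin n → ℝ) → ℝ≥0∞} (hG : Measurable G) :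
    ∫⁻ z, G (observations a x n z) ∂stdGaussianPi n =
      ∫⁻ y, G y * ∏ i, gaussianLR (x (queries a n y i)) (y i) ∂stdGaussianPi n := by
  have hobs (n : ℕ) : Measurable (observations a x n) :=
    (measurable_observations (Ω := Unit) (a := fun _ => a) (x := fun _ => x)
      (fun n => (ha n).comp measurable_snd) measurable_const n).comp
      (measurable_const (a := ()) |>.prodMk measurable_id)
  have hx : Measurable x := measurable_of_countable x
  have hL (n : ℕ) : Measurable fun y : Fin n → ℝ =>
      ∏ i, gaussianLR (x (queries a n y i)) (y i) :=
    measurable_comp_queries ha measurable_id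
      (f := fun α y => ∏ i, gaussianLR (x (α i)) (y i)) fun α => by fun_prop
  induction n with
  | zero =>
    refine lintegral_congr fun y => ?_
    simp [Subsingleton.elim (observations a x 0 y) y]
  | succ n ih =>
    rw [lintegral_stdGaussianPi_succ n (G := fun z => G (observations a x (n + 1) z)) (hG.comp (hobs _)),
      lintegral_stdGaussianPi_succ n (G := fun y => G y * ∏ i,
        gaussianLR (x (queries a (n + 1) y i)) (y i)) (hG.mul (hL _))]
    have hG' := hG.comp (measurable_snoc n)
    have hH : Measurable fun y : Fin n → ℝ => ∫⁻ t, G (Fin.snoc (α := fun _ => ℝ) y t) *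
        gaussianLR (x (a n y)) t ∂gaussianReal 0 1 := by
      refine Measurable.lintegral_prod_right' (f := fun p : (Fin n → ℝ) × ℝ =>
        G (Fin.snoc (α := fun _ => ℝ) p.1 p.2) * gaussianLR (x (a n p.1)) p.2) ?_
      exact hG'.mul (measurable_gaussianLR (hx.comp ((ha n).comp measurable_fst)) measurable_snd)
    calc _ = ∫⁻ z, (fun y => ∫⁻ t, G (Fin.snoc (α := fun _ => ℝ) y t) *
          gaussianLR (x (a n y)) t ∂gaussianReal 0 1) (observations a x n z) ∂stdGaussianPi n := by
          refine lintegral_congr fun z => ?_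
          simp only [observations, Fin.init_snoc, Fin.snoc_last]
          exact lintegral_gaussianReal_const_add _
            (hG'.comp (measurable_const.prodMk measurable_id))
      _ = _ := by
          rw [ih hH]
          refine lintegral_congr fun y => ?_
          have hGy : Measurable fun t => G (Fin.snoc (α := fun _ => ℝ) y t) *
              gaussianLR (x (a n y)) t :=
            (hG'.comp (measurable_const.prodMk measurable_id)).mul (by fun_prop)
          rw [← lintegral_mul_const _ hGy]
          refine lintegral_congr fun t => ?_
          simp only [queries, Fin.prod_univ_castSucc, Fin.init_snoc, Fin.snoc_last,
            Fin.snoc_castSucc]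
          ring

/-- Count and sum are sufficient statistics for each point. Grouping by point lets the independent
latent points be integrated out one factor at a time. -/
theorem prod_gaussianLR_eq {n : ℕ} (α : Fin n → ℕ) (y : Fin n → ℝ) (x : ℕ → ℝ) :
    ∏ i, gaussianLR (x (α i)) (y i) = ∏ b ∈ Finset.univ.image α,
      ENNReal.ofReal (Real.exp (x b * querySum α y b - queryCount α b * x b ^ 2 / 2)) := by
  rw [← Finset.prod_fiberwise_of_maps_to (s := Finset.univ) (t := Finset.univ.image α) (g := α)
    (fun i _ => Finset.mem_image_of_mem _ (Finset.mem_univ i))]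
  refine Finset.prod_congr rfl fun b _ => ?_
  have : ∀ i ∈ Finset.univ.filter (fun i => α i = b), gaussianLR (x (α i)) (y i) =
      ENNReal.ofReal (Real.exp (x b * y i - x b ^ 2 / 2)) := by
    intro i hi
    rw [(Finset.mem_filter.1 hi).2, gaussianLR]
  rw [Finset.prod_congr rfl this, ← ENNReal.ofReal_prod_of_nonneg fun _ _ => (Real.exp_pos _).le,
    ← Real.exp_sum, Finset.sum_sub_distrib, ← Finset.mul_sum, querySum, queryCount,
    ← Finset.sum_filter, ← Finset.sum_filter]
  congr 3
  simp
  ring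

theorem measurable_pointLR (μ : ProbabilityMeasure ℝ) (k : ℕ) :
    Measurable (pointLR (μ : Measure ℝ) k) := by
  unfold pointLR
  refine Measurable.lintegral_prod_right' (f := fun p : ℝ × ℝ =>
    ENNReal.ofReal (Real.exp (p.2 * p.1 - k * p.2 ^ 2 / 2))) (by fun_prop)

theorem measurable_queryProd {w : ℕ → ℝ → ℝ≥0∞} (hw : ∀ k, Measurable (w k)) {n : ℕ}
    (α : Fin n → ℕ) : Measurable (queryProd w α) :=
  Finset.measurable_prod _ fun b _ => (hw _).comp (measurable_querySum α b)

/-- Integrating out the latent points. -/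
theorem lintegral_lintegral_observations {a : (n : ℕ) → (Fin n → ℝ) → ℕ}
    (ha : ∀ n, Measurable (a n)) (μ : ProbabilityMeasure ℝ) (n : ℕ) {G : (Fin n → ℝ) → ℝ≥0∞}
    (hG : Measurable G) :
    ∫⁻ x, ∫⁻ z, G (observations a x n z) ∂stdGaussianPi n
        ∂(Measure.infinitePi fun _ : ℕ => (μ : Measure ℝ)) =
      ∫⁻ y, G y * queryProd (pointLR (μ : Measure ℝ)) (queries a n y) y ∂stdGaussianPi n := by
  simp_rw [lintegral_observations ha _ n hG]
  have hm : Measurable fun p : (ℕ → ℝ) × (Fin n → ℝ) =>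
      G p.2 * ∏ i, gaussianLR (p.1 (queries a n p.2 i)) (p.2 i) :=
    measurable_comp_queries ha measurable_snd (f := fun α (p : (ℕ → ℝ) × (Fin n → ℝ)) =>
      G p.2 * ∏ i, gaussianLR (p.1 (α i)) (p.2 i)) fun α => by fun_prop
  rw [lintegral_lintegral_swap hm.aemeasurable]
  refine lintegral_congr fun y => ?_
  rw [lintegral_const_mul _ (by fun_prop)]
  simp_rw [prod_gaussianLR_eq]
  rw [lintegral_infinitePi_prod μ _ (f := fun b x => ENNReal.ofReal (Real.exp
    (x * querySum (queries a n y) y b - queryCount (queries a n y) b * x ^ 2 / 2)))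
    fun b => by fun_prop]
  rfl

/-! ### Supermartingale products over the queried points. -/

theorem queryProd_eq_prod {w : ℕ → ℝ → ℝ≥0∞} (h0 : w 0 0 = 1) {n : ℕ} (α : Fin n → ℕ)
    (y : Fin n → ℝ) {B : Finset ℕ} (hB : Finset.univ.image α ⊆ B) :
    queryProd w α y = ∏ b ∈ B, w (queryCount α b) (querySum α y b) := by
  refine Finset.prod_subset hB fun b _ hb => ?_
  have h : ∀ i, ¬ α i = b := fun i hi => hb (by simp [← hi])
  simp [queryCount, querySum, h, h0]

/-- A query of `c` changes only the factor of `c`; `P` collects the others and does not involve the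
new value `t`. The normalisation `w 0 0 = 1` covers a point not queried before. -/
theorem queryProd_snoc {w : ℕ → ℝ → ℝ≥0∞} (h0 : w 0 0 = 1) {n : ℕ} (α : Fin n → ℕ)
    (y : Fin n → ℝ) (c : ℕ) : ∃ P : ℝ≥0∞,
      queryProd w α y = P * w (queryCount α c) (querySum α y c) ∧ ∀ t : ℝ,
      queryProd w (Fin.snoc (α := fun _ => ℕ) α c) (Fin.snoc (α := fun _ => ℝ) y t) =
        P * w (queryCount α c + 1) (querySum α y c + t) := by
  refine ⟨∏ b ∈ (Finset.univ.image α).erase c, w (queryCount α b) (querySum α y b), ?_,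
    fun t => ?_⟩
  · rw [queryProd_eq_prod h0 α y (Finset.subset_insert c _), ← Finset.mul_prod_erase _ _
      (Finset.mem_insert_self c _), Finset.erase_insert_eq_erase, mul_comm]
  · have hB : Finset.univ.image (Fin.snoc (α := fun _ => ℕ) α c : Fin (n + 1) → ℕ) ⊆
        insert c (Finset.univ.image α) := by
      intro b hb
      obtain ⟨i, -, rfl⟩ := Finset.mem_image.1 hb
      refine Fin.lastCases ?_ (fun j => ?_) i <;> simp
    rw [queryProd_eq_prod h0 _ _ hB, ← Finset.mul_prod_erase _ _
      (Finset.mem_insert_self c _), Finset.erase_insert_eq_erase, mul_comm]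
    congr 1
    · refine Finset.prod_congr rfl fun b hb => ?_
      have : c ≠ b := (Finset.ne_of_mem_erase hb).symm
      simp only [queryCount, querySum, Fin.sum_univ_castSucc, Fin.snoc_castSucc, Fin.snoc_last,
        this, if_false, add_zero]
    · simp only [queryCount, querySum, Fin.sum_univ_castSucc, Fin.snoc_castSucc, Fin.snoc_last,
        if_true]

/-- A product of supermartingales along an adaptive querying rule is a supermartingale. -/
theorem lintegral_queryProd_le {a : (n : ℕ) → (Fin n → ℝ) → ℕ} (ha : ∀ n, Measurable (a n))
    {w : ℕ → ℝ → ℝ≥0∞} (hw : ∀ k, Measurable (w k)) (h0 : w 0 0 = 1)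
    (hstep : ∀ k s, ∫⁻ t, w (k + 1) (s + t) ∂gaussianReal 0 1 ≤ w k s) (n : ℕ) :
    ∫⁻ y, queryProd w (queries a n y) y ∂stdGaussianPi n ≤ 1 := by
  have hm (n : ℕ) : Measurable fun y : Fin n → ℝ => queryProd w (queries a n y) y :=
    measurable_comp_queries ha measurable_id (f := fun α y => queryProd w α y)
      fun α => measurable_queryProd hw α
  induction n with
  | zero => simp [queryProd]
  | succ n ih =>
    rw [lintegral_stdGaussianPi_succ n (hm _)]
    refine le_trans (lintegral_mono fun y => ?_) ih
    obtain ⟨P, h1, h2⟩ := queryProd_snoc h0 (queries a n y) y (a n y)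
    simp only [queries, Fin.init_snoc, h1, h2]
    have hwt (k : ℕ) (s : ℝ) : Measurable fun t => w k (s + t) := (hw k).comp (by fun_prop)
    rw [lintegral_const_mul _ (hwt _ _)]
    gcongr
    exact hstep _ _

theorem sum_queryCount_le {n : ℕ} (α : Fin n → ℕ) (B : Finset ℕ) :
    ∑ b ∈ B, queryCount α b ≤ n := by
  unfold queryCount
  rw [Finset.sum_comm]
  calc _ ≤ ∑ _i : Fin n, 1 := Finset.sum_le_sum fun i _ => by
        rw [Finset.sum_ite_eq]; split_ifs <;> simp
    _ = n := by simp

/-- At most `n` distinct points pay `c`. A point paying `κ` uses at least `m + 1` of the `n`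
queries, so there are at most `n / (m + 1)` of them. -/
theorem sq_queryProd_le {ℓ₀ ℓ₁ w : ℕ → ℝ → ℝ≥0∞} {c κ : ℝ≥0∞} {m : ℕ} (hc : 1 ≤ c) (hκ : 1 ≤ κ)
    (h : ∀ k s, ℓ₁ k s ^ 2 ≤ c * (if m < k then κ else 1) * w k s * ℓ₀ k s) {n : ℕ}
    (α : Fin n → ℕ) (y : Fin n → ℝ) :
    queryProd ℓ₁ α y ^ 2 ≤ c ^ n * κ ^ (n / (m + 1)) * queryProd w α y * queryProd ℓ₀ α y := by
  set B := Finset.univ.image α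
  have hB : B.card ≤ n := Finset.card_image_le.trans (by simp)
  have hH : (B.filter fun b => m < queryCount α b).card ≤ n / (m + 1) := by
    rw [Nat.le_div_iff_mul_le (Nat.succ_pos m)]
    refine le_trans ?_ (sum_queryCount_le α (B.filter fun b => m < queryCount α b))
    rw [← smul_eq_mul]
    exact Finset.card_nsmul_le_sum _ _ _ fun b hb => (Finset.mem_filter.1 hb).2
  calc queryProd ℓ₁ α y ^ 2 = ∏ b ∈ B, ℓ₁ (queryCount α b) (querySum α y b) ^ 2 :=
        (Finset.prod_pow _ _ _).symm
    _ ≤ ∏ b ∈ B, (c * (if m < queryCount α b then κ else 1) *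
          w (queryCount α b) (querySum α y b) * ℓ₀ (queryCount α b) (querySum α y b)) :=
        Finset.prod_le_prod' fun b _ => h _ _
    _ = c ^ B.card * κ ^ (B.filter fun b => m < queryCount α b).card * queryProd w α y *
          queryProd ℓ₀ α y := by
        rw [Finset.prod_mul_distrib, Finset.prod_mul_distrib, Finset.prod_mul_distrib,
          Finset.prod_const, Finset.prod_ite]
        simp [queryProd, B]
    _ ≤ _ := by gcongr

/-! ### Law of the observations and `χ²` comparison. -/

theorem observations_eq_obs {S : Type*} [MeasurableSpace S] (π : OnlineAlgorithm S)
    (ω : S × (ℕ → ℝ) × (ℕ → ℝ)) (n : ℕ) :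
    π.obs ω n = observations (fun n y => π.arm n (ω.1, y)) ω.2.1 n fun i => ω.2.2 i := by
  induction n with
  | zero => rfl
  | succ n ih =>
    have : (Fin.init fun i : Fin (n + 1) => ω.2.2 i) = fun i : Fin n => ω.2.2 i := rfl
    simp only [OnlineAlgorithm.obs, observations, this, ← ih, Fin.val_last]

theorem measurable_obs {S : Type*} [MeasurableSpace S] (π : OnlineAlgorithm S) (n : ℕ) :
    Measurable fun ω => π.obs ω n := by
  simp_rw [observations_eq_obs]
  refine (measurable_observations (Ω := S × (ℕ → ℝ) × (ℕ → ℝ))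
    (a := fun ω n y => π.arm n (ω.1, y)) (x := fun ω => ω.2.1) (fun n => ?_)
    (by fun_prop) n).comp (measurable_id.prodMk (by fun_prop :
      Measurable fun (ω : S × (ℕ → ℝ) × (ℕ → ℝ)) (i : Fin n) => ω.2.2 i))
  exact (π.measurable_arm n).comp
    ((measurable_fst.comp measurable_fst).prodMk measurable_snd)

theorem measurable_queryProd_queries {S : Type*} [MeasurableSpace S]
    {a : S → (n : ℕ) → (Fin n → ℝ) → ℕ}
    (ha : ∀ n, Measurable fun p : S × (Fin n → ℝ) => a p.1 n p.2) {w : ℕ → ℝ → ℝ≥0∞}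
    (hw : ∀ k, Measurable (w k)) (n : ℕ) :
    Measurable fun q : S × (Fin n → ℝ) => queryProd w (queries (a q.1) n q.2) q.2 := by
  have h : Measurable fun u : (Fin n → ℕ) × (Fin n → ℝ) => queryProd w u.1 u.2 :=
    measurable_from_prod_countable_right fun α => measurable_queryProd hw α
  have hf : Measurable fun q : S × (Fin n → ℝ) => (queries (a q.1) n q.2, q.2) :=
    (measurable_queries ha n).prodMk measurable_snd
  exact Measurable.comp (g := fun u : (Fin n → ℕ) × (Fin n → ℝ) => queryProd w u.1 u.2)
    (f := fun q : S × (Fin n → ℝ) => (queries (a q.1) n q.2, q.2)) h hf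

/-- The law of the seed and the first `n` observations. -/
theorem law_obs_mem {S : Type*} [MeasurableSpace S] (π : OnlineAlgorithm S)
    (μ : ProbabilityMeasure ℝ) (n : ℕ) {A : Set (S × (Fin n → ℝ))} (hA : MeasurableSet A) :
    π.law μ {ω | (ω.1, π.obs ω n) ∈ A} =
      ∫⁻ q, A.indicator 1 q * queryProd (pointLR (μ : Measure ℝ))
        (queries (fun n y => π.arm n (q.1, y)) n q.2) q.2 ∂π.seedLaw.prod (stdGaussianPi n) := by
  have := π.isProbabilityMeasure_seedLaw
  have hm : Measurable fun ω => (ω.1, π.obs ω n) := measurable_fst.prodMk (measurable_obs π n)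
  have hI : Measurable (A.indicator (1 : S × (Fin n → ℝ) → ℝ≥0∞)) := measurable_one.indicator hA
  have hF : Measurable fun ω => A.indicator (1 : S × (Fin n → ℝ) → ℝ≥0∞) (ω.1, π.obs ω n) :=
    hI.comp hm
  have h1 : π.law μ {ω | (ω.1, π.obs ω n) ∈ A} =
      ∫⁻ ω, A.indicator (1 : S × (Fin n → ℝ) → ℝ≥0∞) (ω.1, π.obs ω n) ∂π.law μ :=
    (lintegral_indicator_one (hm hA)).symm
  have hIp : Measurable fun q : S × (Fin n → ℝ) => A.indicator 1 q *
      queryProd (pointLR (μ : Measure ℝ)) (queries (fun n y => π.arm n (q.1, y)) n q.2) q.2 :=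
    hI.mul (measurable_queryProd_queries (a := fun s n y => π.arm n (s, y)) π.measurable_arm
      (measurable_pointLR μ) n)
  rw [h1, OnlineAlgorithm.law, lintegral_prod _ hF.aemeasurable,
    lintegral_prod _ hIp.aemeasurable]
  refine lintegral_congr fun s => ?_
  have hFs : Measurable fun q : (ℕ → ℝ) × (ℕ → ℝ) =>
      A.indicator (1 : S × (Fin n → ℝ) → ℝ≥0∞) (s, π.obs (s, q) n) :=
    hF.comp (measurable_const.prodMk measurable_id)
  rw [lintegral_prod _ hFs.aemeasurable]
  have hG : Measurable fun y => A.indicator (1 : S × (Fin n → ℝ) → ℝ≥0∞) (s, y) :=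
    hI.comp (measurable_const.prodMk measurable_id)
  have ha (n : ℕ) : Measurable fun y : Fin n → ℝ => π.arm n (s, y) :=
    (π.measurable_arm n).comp (measurable_const.prodMk measurable_id)
  rw [← lintegral_lintegral_observations ha μ n hG]
  refine lintegral_congr fun x => ?_
  have hGx : Measurable fun z => A.indicator (1 : S × (Fin n → ℝ) → ℝ≥0∞)
      (s, observations (fun n y => π.arm n (s, y)) x n z) :=
    hG.comp ((measurable_observations (Ω := Unit) (a := fun _ n y => π.arm n (s, y))
      (x := fun _ => x) (fun n => (ha n).comp measurable_snd) measurable_const n).comp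
      (measurable_const (a := ()) |>.prodMk measurable_id))
  simp_rw [observations_eq_obs]
  rw [← map_infinitePi_gaussian_restrict, lintegral_map hGx (by fun_prop)]

/-- For densities `p₀`, `p₁` and an indicator `g`, integration bounds a difference of probabilities
without dividing by `p₀`. The case `g = 1` is `√(v p₀) ≤ v + p₀ / 4`, the case `g = 0` follows from
`2 √(v p₀) ≤ v + p₀`. -/
theorem mul_add_le_of_sq_le {p₀ p₁ v : ℝ≥0∞} (h₀ : p₀ ≠ ∞) (h₁ : p₁ ≠ ∞) (h : p₁ ^ 2 ≤ v * p₀)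
    {g : ℝ≥0∞} (hg : g = 0 ∨ g = 1) :
    g * p₀ + 2 * p₁ ≤ g * p₁ + v + ENNReal.ofReal (5 / 4) * p₀ := by
  rcases eq_or_ne v ∞ with rfl | hv
  · simp
  lift p₀ to NNReal using h₀
  lift p₁ to NNReal using h₁
  lift v to NNReal using hv
  have h' : (p₁ : ℝ) ^ 2 ≤ v * p₀ := by exact_mod_cast h
  have e : ENNReal.ofReal (5 / 4) = ((5 / 4 : NNReal) : ℝ≥0∞) := by
    rw [ENNReal.ofReal, ENNReal.coe_inj, ← NNReal.coe_inj, Real.coe_toNNReal _ (by norm_num)]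
    norm_num
  have hp₀ := p₀.2
  have hp₁ := p₁.2
  have hv := v.2
  have k1 : (p₁ : ℝ) ≤ v + p₀ / 4 := by
    refine abs_le_of_sq_le_sq' ?_ (by positivity) |>.2
    nlinarith [sq_nonneg ((v : ℝ) - p₀ / 4)]
  have k2 : 2 * (p₁ : ℝ) ≤ v + p₀ := by
    refine abs_le_of_sq_le_sq' ?_ (by positivity) |>.2
    nlinarith [sq_nonneg ((v : ℝ) - p₀)]
  rw [e]
  rcases hg with rfl | rfl
  · rw [zero_mul, zero_mul, zero_add, zero_add]
    norm_cast
    rw [← NNReal.coe_le_coe]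
    push_cast
    linarith
  · rw [one_mul, one_mul]
    norm_cast
    rw [← NNReal.coe_le_coe]
    push_cast
    linarith

theorem queryProd_ne_top {ℓ : ℕ → ℝ → ℝ≥0∞} (hℓ : ∀ k s, ℓ k s ≠ ∞) {n : ℕ}
    (α : Fin n → ℕ) (y : Fin n → ℝ) : queryProd ℓ α y ≠ ∞ :=
  ENNReal.prod_ne_top fun _ _ => hℓ _ _

theorem lintegral_add_two_le {Ω : Type*} [MeasurableSpace Ω] {P : Measure Ω}
    {f₀ f₁ p₀ p₁ v : Ω → ℝ≥0∞} {C V : ℝ≥0∞} (hf₁ : Measurable f₁) (hf₀ : Measurable f₀)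
    (hp₀ : Measurable p₀) (hp₁ : Measurable p₁)
    (hv : Measurable v) (h₀ : ∫⁻ ω, p₀ ω ∂P = 1) (h₁ : ∫⁻ ω, p₁ ω ∂P = 1)
    (h : ∀ ω, f₀ ω + 2 * p₁ ω ≤ f₁ ω + v ω + C * p₀ ω) (hV : ∫⁻ ω, v ω ∂P ≤ V) :
    ∫⁻ ω, f₀ ω ∂P + 2 ≤ ∫⁻ ω, f₁ ω ∂P + V + C := by
  have := lintegral_mono (μ := P) h
  rw [lintegral_add_left hf₀, lintegral_const_mul _ hp₁, h₁,
    lintegral_add_left (f := fun ω => f₁ ω + v ω) (hf₁.add hv), lintegral_add_left hf₁, lintegral_const_mul _ hp₀, h₀,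
    mul_one, mul_one] at this
  exact this.trans (by gcongr)

/-- If the likelihood ratios of a single point are controlled in the `χ²` sense by a
supermartingale `w`, the laws of the first `n` observations are close. -/
theorem law_obs_mem_le {S : Type*} [MeasurableSpace S] (π : OnlineAlgorithm S)
    {μ₀ μ₁ : ProbabilityMeasure ℝ} (hf₀ : ∀ k s, pointLR (μ₀ : Measure ℝ) k s ≠ ∞)
    (hf₁ : ∀ k s, pointLR (μ₁ : Measure ℝ) k s ≠ ∞) {w : ℕ → ℝ → ℝ≥0∞} {c κ : ℝ≥0∞} {m : ℕ}
    (hc : 1 ≤ c) (hκ : 1 ≤ κ) (hw : ∀ k, Measurable (w k)) (h0 : w 0 0 = 1)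
    (hstep : ∀ k s, ∫⁻ t, w (k + 1) (s + t) ∂gaussianReal 0 1 ≤ w k s)
    (h : ∀ k s, pointLR (μ₁ : Measure ℝ) k s ^ 2 ≤
      c * (if m < k then κ else 1) * w k s * pointLR (μ₀ : Measure ℝ) k s)
    (n : ℕ) {A : Set (S × (Fin n → ℝ))} (hA : MeasurableSet A) :
    π.law μ₀ {ω | (ω.1, π.obs ω n) ∈ A} + 2 ≤
      π.law μ₁ {ω | (ω.1, π.obs ω n) ∈ A} + c ^ n * κ ^ (n / (m + 1)) +
        ENNReal.ofReal (5 / 4) := by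
  have := π.isProbabilityMeasure_seedLaw
  have hlaw (μ : ProbabilityMeasure ℝ) : π.law μ Set.univ = 1 := by
    rw [OnlineAlgorithm.law]; simp
  have hone (μ : ProbabilityMeasure ℝ) : ∫⁻ q, queryProd (pointLR (μ : Measure ℝ))
      (queries (fun n y => π.arm n (q.1, y)) n q.2) q.2 ∂π.seedLaw.prod (stdGaussianPi n) = 1 := by
    have := law_obs_mem π μ n (A := Set.univ) MeasurableSet.univ
    simpa [hlaw] using this.symm
  have hI : Measurable (A.indicator (1 : S × (Fin n → ℝ) → ℝ≥0∞)) := measurable_one.indicator hA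
  have hwm : Measurable fun q : S × (Fin n → ℝ) =>
      queryProd w (queries (fun n y => π.arm n (q.1, y)) n q.2) q.2 := by
    exact measurable_queryProd_queries (a := fun s n y => π.arm n (s, y)) π.measurable_arm hw n
  have hp (μ : ProbabilityMeasure ℝ) : Measurable fun q : S × (Fin n → ℝ) =>
      queryProd (pointLR (μ : Measure ℝ)) (queries (fun n y => π.arm n (q.1, y)) n q.2) q.2 :=
    measurable_queryProd_queries (a := fun s n y => π.arm n (s, y)) π.measurable_arm
      (measurable_pointLR μ) n
  rw [law_obs_mem π μ₀ n hA, law_obs_mem π μ₁ n hA]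
  refine lintegral_add_two_le (hI.mul (hp μ₁)) (hI.mul (hp μ₀)) (hp μ₀) (hp μ₁)
    (hwm.const_mul (c ^ n * κ ^ (n / (m + 1)))) (hone μ₀) (hone μ₁) (fun q => ?_) ?_
  · refine mul_add_le_of_sq_le (queryProd_ne_top hf₀ _ _)
      (queryProd_ne_top hf₁ _ _) (sq_queryProd_le hc hκ h _ _) ?_
    by_cases hq : q ∈ A <;> simp [hq]
  · rw [lintegral_const_mul _ hwm, lintegral_prod _ hwm.aemeasurable]
    refine mul_le_of_le_one_right' ?_
    -- For a fixed seed the querying rule is deterministic.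
    calc _ ≤ ∫⁻ _ : S, 1 ∂π.seedLaw := lintegral_mono fun s => lintegral_queryProd_le
          (fun n => (π.measurable_arm n).comp (measurable_const.prodMk measurable_id)) hw h0 hstep n
      _ = 1 := by simp

/-! ### The tilted laws, their medians and the class. -/

/-- Density `c` on `(-w, w]` and atoms at `±w`, `±3w`, with masses tilted by `d`. The moments up to
order `2` do not depend on `d`. -/
noncomputable def tiltedMeasure (c w q d : ℝ) : Measure ℝ :=
  ENNReal.ofReal c • volume.restrict (Set.Ioc (-w) w) +
    ENNReal.ofReal (q * (1 - d)) • Measure.dirac (-(3 * w)) +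
    ENNReal.ofReal (3 * q * (1 + d)) • Measure.dirac (-w) +
    ENNReal.ofReal (3 * q * (1 - d)) • Measure.dirac w +
    ENNReal.ofReal (q * (1 + d)) • Measure.dirac (3 * w)

theorem lintegral_tiltedMeasure (c w q d : ℝ) {f : ℝ → ℝ≥0∞} (hf : Measurable f) :
    ∫⁻ x, f x ∂tiltedMeasure c w q d =
      ENNReal.ofReal c * (∫⁻ x in Set.Ioc (-w) w, f x) +
        ENNReal.ofReal (q * (1 - d)) * f (-(3 * w)) +
        ENNReal.ofReal (3 * q * (1 + d)) * f (-w) + ENNReal.ofReal (3 * q * (1 - d)) * f w +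
        ENNReal.ofReal (q * (1 + d)) * f (3 * w) := by
  simp only [tiltedMeasure, lintegral_add_measure, lintegral_smul_measure, lintegral_dirac' _ hf,
    smul_eq_mul]

theorem tiltedMeasure_apply {c w q d : ℝ} {A : Set ℝ} (hA : MeasurableSet A) :
    tiltedMeasure c w q d A = ENNReal.ofReal c * volume (A ∩ Set.Ioc (-w) w) +
      ENNReal.ofReal (q * (1 - d)) * A.indicator 1 (-(3 * w)) +
      ENNReal.ofReal (3 * q * (1 + d)) * A.indicator 1 (-w) +
      ENNReal.ofReal (3 * q * (1 - d)) * A.indicator 1 w +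
      ENNReal.ofReal (q * (1 + d)) * A.indicator 1 (3 * w) := by
  simp [tiltedMeasure, Measure.dirac_apply' _ hA, Measure.restrict_apply hA]

theorem isProbabilityMeasure_tiltedMeasure {c w q d : ℝ} (hc : 0 < c) (hw : 0 < w) (hq : 0 < q)
    (h : 8 * q + 2 * c * w = 1) (hd0 : 0 ≤ d) (hd : d ≤ 1) :
    IsProbabilityMeasure (tiltedMeasure c w q d) := by
  constructor
  have h1 : 0 ≤ 1 - d := by linarith
  rw [tiltedMeasure_apply MeasurableSet.univ, Set.univ_inter, Real.volume_Ioc]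
  simp only [Set.indicator_univ, Pi.one_apply, mul_one]
  rw [← ENNReal.ofReal_mul hc.le, ← ENNReal.ofReal_add (by nlinarith) (by positivity),
    ← ENNReal.ofReal_add (by nlinarith [mul_nonneg hq.le h1]) (by positivity),
    ← ENNReal.ofReal_add (by nlinarith [mul_nonneg hq.le h1, mul_nonneg hq.le hd0]) (by positivity),
    ← ENNReal.ofReal_add (by nlinarith [mul_nonneg hq.le h1, mul_nonneg hq.le hd0]) (by positivity),
    ← ENNReal.ofReal_one]
  congr 1
  linarith

/-- `tiltedMeasure` as a probability measure. -/
noncomputable def tiltedLaw {c w q d : ℝ} (hc : 0 < c) (hw : 0 < w) (hq : 0 < q)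
    (h : 8 * q + 2 * c * w = 1) (hd0 : 0 ≤ d) (hd : d ≤ 1) : ProbabilityMeasure ℝ :=
  ⟨tiltedMeasure c w q d, isProbabilityMeasure_tiltedMeasure hc hw hq h hd0 hd⟩

/-- Only the atoms at `-3w` and `-w` lie below `x`; the tilt changes their total mass by `-qd + 3qd
= 2qd`. -/
theorem cdf_tiltedMeasure {c w q d : ℝ} (hc : 0 < c) (hw : 0 < w) (hq : 0 < q)
    (h : 8 * q + 2 * c * w = 1) (hd0 : 0 ≤ d) (hd : d ≤ 1) {x : ℝ} (hx : x ∈ Set.Ioo (-w) w) :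
    cdf (tiltedMeasure c w q d) x = 1 / 2 + 2 * q * d + c * x := by
  have := isProbabilityMeasure_tiltedMeasure hc hw hq h hd0 hd
  have h1 : 0 ≤ 1 - d := by linarith
  have hI : Set.Iic x ∩ Set.Ioc (-w) w = Set.Ioc (-w) x := by
    ext y; simp only [Set.mem_inter_iff, Set.mem_Iic, Set.mem_Ioc]
    constructor
    · rintro ⟨h1, h2, -⟩; exact ⟨h2, h1⟩
    · rintro ⟨h1, h2⟩; exact ⟨h2, h1, h2.trans hx.2.le⟩
  obtain ⟨hx1, hx2⟩ := hx
  have e1 : (-(3 * w)) ∈ Set.Iic x := by simp only [Set.mem_Iic]; linarith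
  have e2 : (-w) ∈ Set.Iic x := by simp only [Set.mem_Iic]; linarith
  have e3 : w ∉ Set.Iic x := by simp only [Set.mem_Iic]; linarith
  have e4 : 3 * w ∉ Set.Iic x := by simp only [Set.mem_Iic]; linarith
  have hx3 : 0 ≤ x + w := by linarith
  rw [cdf_eq_real, measureReal_def, tiltedMeasure_apply measurableSet_Iic, hI, Real.volume_Ioc,
    Set.indicator_of_mem e1, Set.indicator_of_mem e2, Set.indicator_of_notMem e3,
    Set.indicator_of_notMem e4]
  simp only [Pi.one_apply, mul_one, mul_zero, add_zero, sub_neg_eq_add]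
  rw [← ENNReal.ofReal_mul hc.le, ← ENNReal.ofReal_add (by positivity) (by positivity),
    ← ENNReal.ofReal_add (by positivity) (by positivity), ENNReal.toReal_ofReal (by positivity)]
  linarith

theorem median_eq_of_cdf {μ : ProbabilityMeasure ℝ} {c w g : ℝ} (hc : 0 < c)
    (hg : g ∈ Set.Ioo (-w) w)
    (h : ∀ x ∈ Set.Ioo (-w) w, cdf (μ : Measure ℝ) x = 1 / 2 + c * (x - g)) : median μ = g := by
  refine IsLeast.csInf_eq ⟨?_, fun x hx => ?_⟩
  · have : cdf (μ : Measure ℝ) g = 1 / 2 := by rw [h g hg]; simp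
    exact this.ge
  · by_contra! hxg
    obtain ⟨y, hy1, hy2⟩ := exists_between (max_lt hxg hg.1)
    have hy : y ∈ Set.Ioo (-w) w := ⟨(le_max_right _ _).trans_lt hy1, hy2.trans hg.2⟩
    have h1 := monotone_cdf (μ : Measure ℝ) ((le_max_left x (-w)).trans hy1.le)
    rw [h y hy] at h1
    have h2 : 1 / 2 ≤ cdf (μ : Measure ℝ) x := hx
    nlinarith

theorem mem_medianClass_of_cdf {μ : ProbabilityMeasure ℝ} {c c₂ r₁ r₂ w g : ℝ} (hc : 0 < c)
    (hc₂ : 0 ≤ c₂) (hr₁ : |g| + r₁ < w) (hr₂ : |g| + r₂ < w) (hg : g ∈ Set.Ioo (-w) w)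
    (h : ∀ x ∈ Set.Ioo (-w) w, cdf (μ : Measure ℝ) x = 1 / 2 + c * (x - g)) :
    μ ∈ medianClass c c₂ r₁ r₂ := by
  have hloc {x : ℝ} (hx : x ∈ Set.Ioo (-w) w) :
      HasDerivAt (cdf (μ : Measure ℝ)) c x := by
    have h1 : HasDerivAt (fun x : ℝ => 1 / 2 + c * (x - g)) c x := by
      simpa using (((hasDerivAt_id x).sub_const g).const_mul c).const_add (1 / 2)
    refine h1.congr_of_eventuallyEq ?_
    filter_upwards [isOpen_Ioo.mem_nhds hx] with y hy using h y hy
  have hmem {x r : ℝ} (hr : |g| + r < w) (hx : |x - median μ| ≤ r) : x ∈ Set.Ioo (-w) w := by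
    rw [median_eq_of_cdf hc hg h] at hx
    have : |x| ≤ |x - g| + |g| := by simpa using abs_add_le (x - g) g
    exact abs_lt.1 (by linarith)
  refine ⟨fun x hx => ?_, fun x hx => ?_⟩
  · have := hloc (hmem hr₁ hx)
    exact ⟨this.differentiableAt, this.deriv.ge⟩
  · have hev : ∀ᶠ y in 𝓝 x, y ∈ Set.Ioo (-w) w := isOpen_Ioo.mem_nhds (hmem hr₂ hx)
    have h1 : deriv (cdf (μ : Measure ℝ)) =ᶠ[𝓝 x] fun _ => c := by
      filter_upwards [hev] with y hy using (hloc hy).deriv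
    have h2 : HasDerivAt (deriv (cdf (μ : Measure ℝ))) 0 x :=
      (hasDerivAt_const x c).congr_of_eventuallyEq h1
    refine ⟨?_, h2.differentiableAt, ?_⟩
    · filter_upwards [hev] with y hy using (hloc hy).differentiableAt
    · rw [h2.deriv]; simpa using hc₂

/-! ### Likelihood ratios of a single point. -/

theorem lintegral_pointLR_succ (μ : Measure ℝ) [SFinite μ] (k : ℕ) (s : ℝ) :
    ∫⁻ t, pointLR μ (k + 1) (s + t) ∂gaussianReal 0 1 = pointLR μ k s := by
  unfold pointLR
  rw [lintegral_lintegral_swap (by fun_prop)]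
  refine lintegral_congr fun x => ?_
  have h1 (t : ℝ) : ENNReal.ofReal (Real.exp (x * (s + t) - ((k + 1 : ℕ) : ℝ) * x ^ 2 / 2)) =
      ENNReal.ofReal (Real.exp (x * s - k * x ^ 2 / 2)) * gaussianLR x t := by
    rw [gaussianLR, ← ENNReal.ofReal_mul (Real.exp_pos _).le, ← Real.exp_add]
    congr 2; push_cast; ring
  have h2 : ∫⁻ t, gaussianLR x t ∂gaussianReal 0 1 = 1 := by
    simpa using (lintegral_gaussianReal_const_add x (f := fun _ => 1) measurable_const).symm
  simp_rw [h1]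
  rw [lintegral_const_mul _ (by fun_prop), h2, mul_one]

/-- The likelihood ratio of `k` observations with sum `s` of the point `x`. -/
noncomputable def expLR (k : ℕ) (s x : ℝ) : ℝ := Real.exp (x * s - k * x ^ 2 / 2)

/-- The effect of the tilting on the likelihood ratio. -/
noncomputable def tiltLR (w : ℝ) (k : ℕ) (s : ℝ) : ℝ :=
  -expLR k s (-(3 * w)) + 3 * expLR k s (-w) - 3 * expLR k s w + expLR k s (3 * w)

/-- The likelihood ratio of the untilted law. -/
noncomputable def baseLR (c w q : ℝ) (k : ℕ) (s : ℝ) : ℝ :=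
  c * (∫⁻ x in Set.Ioc (-w) w, ENNReal.ofReal (expLR k s x)).toReal +
    q * (expLR k s (-(3 * w)) + 3 * expLR k s (-w) + 3 * expLR k s w + expLR k s (3 * w))

theorem expLR_pos (k : ℕ) (s x : ℝ) : 0 < expLR k s x := Real.exp_pos _

theorem lintegral_expLR_ne_top (w : ℝ) (k : ℕ) (s : ℝ) :
    ∫⁻ x in Set.Ioc (-w) w, ENNReal.ofReal (expLR k s x) ≠ ∞ := by
  have hcont : Continuous (expLR k s) := by unfold expLR; fun_prop
  have : IntegrableOn (expLR k s) (Set.Ioc (-w) w) :=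
    (hcont.integrableOn_Icc).mono_set Set.Ioc_subset_Icc_self
  exact (this.lintegral_lt_top).ne

theorem pointLR_tiltedMeasure {c w q d : ℝ} (hc : 0 < c) (hq : 0 < q) (hd0 : 0 ≤ d) (hd : d ≤ 1)
    (k : ℕ) (s : ℝ) : pointLR (tiltedMeasure c w q d) k s =
      ENNReal.ofReal (baseLR c w q k s + d * q * tiltLR w k s) := by
  have h1 : 0 ≤ 1 - d := by linarith
  have e (x : ℝ) := (expLR_pos k s x).le
  change ∫⁻ x, ENNReal.ofReal (expLR k s x) ∂_ = _
  have hm : Measurable fun x => ENNReal.ofReal (expLR k s x) := by unfold expLR; fun_prop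
  rw [lintegral_tiltedMeasure _ _ _ _ hm, ← ENNReal.ofReal_toReal (lintegral_expLR_ne_top w k s)]
  set U := (∫⁻ x in Set.Ioc (-w) w, ENNReal.ofReal (expLR k s x)).toReal with hU
  have hU0 : 0 ≤ U := ENNReal.toReal_nonneg
  have t1 := mul_nonneg (mul_nonneg hq.le h1) (e (-(3 * w)))
  have t2 : 0 ≤ 3 * q * (1 + d) * expLR k s (-w) := mul_nonneg (by positivity) (e _)
  have t3 := mul_nonneg (mul_nonneg (by positivity : 0 ≤ 3 * q) h1) (e w)
  have t4 : 0 ≤ q * (1 + d) * expLR k s (3 * w) := mul_nonneg (by positivity) (e _)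
  have t0 := mul_nonneg hc.le hU0
  rw [← ENNReal.ofReal_mul hc.le, ← ENNReal.ofReal_mul (by positivity),
    ← ENNReal.ofReal_mul (by positivity), ← ENNReal.ofReal_mul (by positivity),
    ← ENNReal.ofReal_mul (by positivity), ← ENNReal.ofReal_add t0 t1,
    ← ENNReal.ofReal_add (by linarith) t2, ← ENNReal.ofReal_add (by linarith) t3,
    ← ENNReal.ofReal_add (by linarith) t4]
  congr 1
  rw [baseLR, tiltLR, ← hU]
  ring

/-- The atoms enter both sides with the same weights up to sign. This makes the cost of a point
bounded however often it is queried. -/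
theorem abs_tiltLR_le {c w q : ℝ} (hc : 0 < c) (hq : 0 < q) (k : ℕ) (s : ℝ) :
    |q * tiltLR w k s| ≤ baseLR c w q k s := by
  have e (x : ℝ) := mul_pos hq (expLR_pos k s x)
  have h1 := e (-(3 * w))
  have h2 := e (-w)
  have h3 := e w
  have h4 := e (3 * w)
  have hU : 0 ≤ c * (∫⁻ x in Set.Ioc (-w) w, ENNReal.ofReal (expLR k s x)).toReal :=
    mul_nonneg hc.le ENNReal.toReal_nonneg
  rw [baseLR, tiltLR, abs_le]
  constructor <;> nlinarith

/-- The atoms at `±w` suffice: by `1 + x ≤ exp x`, the terms linear in `s` cancel in their sum. -/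
theorem le_baseLR {c w q : ℝ} (hc : 0 < c) (hq : 1 / 16 ≤ q) {k : ℕ} {m : ℕ} (hk : k ≤ m)
    (hm : m * w ^ 2 ≤ 1 / 9) (s : ℝ) : 1 / 4 ≤ baseLR c w q k s := by
  have h1 := expLR_pos k s (-(3 * w))
  have h4 := expLR_pos k s (3 * w)
  have hU : 0 ≤ c * (∫⁻ x in Set.Ioc (-w) w, ENNReal.ofReal (expLR k s x)).toReal :=
    mul_nonneg hc.le ENNReal.toReal_nonneg
  have hkw : k * w ^ 2 ≤ 1 / 9 := le_trans (by gcongr) hm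
  have h23 : 2 * (1 - k * w ^ 2 / 2) ≤ expLR k s (-w) + expLR k s w := by
    have a1 := Real.add_one_le_exp (-w * s - k * (-w) ^ 2 / 2)
    have a2 := Real.add_one_le_exp (w * s - k * w ^ 2 / 2)
    unfold expLR
    nlinarith
  rw [baseLR]
  nlinarith

/-- The expectation of the square of `tiltLR` after `m` observations, given the first `k`. -/
noncomputable def tiltSq (w : ℝ) (m k : ℕ) (s : ℝ) : ℝ :=
  ∑ i, ∑ j, (![-1, 3, -3, 1] : Fin 4 → ℝ) i * (![-1, 3, -3, 1] : Fin 4 → ℝ) j *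
    (expLR k s ((![-3, -1, 1, 3] : Fin 4 → ℝ) i * w) *
      expLR k s ((![-3, -1, 1, 3] : Fin 4 → ℝ) j * w) *
    Real.exp ((m - k) * (((![-3, -1, 1, 3] : Fin 4 → ℝ) i * w) *
      ((![-3, -1, 1, 3] : Fin 4 → ℝ) j * w))))

/-- Expanding the exponential turns the right side into the sum over `n` of `r^n / n! * (∑ v i * x i
^ n)^2`; the left side is the term `n = 0`. -/
theorem sq_sum_le_sum_mul_exp {ι : Type*} [Fintype ι] (v x : ι → ℝ) {r : ℝ} (hr : 0 ≤ r) :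
    (∑ i, v i) ^ 2 ≤ ∑ i, ∑ j, v i * v j * Real.exp (r * (x i * x j)) := by
  have h : HasSum (fun n : ℕ => r ^ n / n.factorial * (∑ i, v i * x i ^ n) ^ 2)
      (∑ i, ∑ j, v i * v j * Real.exp (r * (x i * x j))) := by
    have h1 : HasSum (fun n : ℕ => ∑ i, ∑ j, v i * v j * ((r * (x i * x j)) ^ n / n.factorial))
        (∑ i, ∑ j, v i * v j * Real.exp (r * (x i * x j))) := by
      refine hasSum_sum fun i _ => hasSum_sum fun j _ => HasSum.mul_left _ ?_
      rw [Real.exp_eq_exp_ℝ]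
      exact NormedSpace.expSeries_div_hasSum_exp _
    convert h1 using 2 with n
    rw [sq, Finset.sum_mul_sum, Finset.mul_sum]
    refine Finset.sum_congr rfl fun i _ => ?_
    rw [Finset.mul_sum]
    refine Finset.sum_congr rfl fun j _ => ?_
    rw [mul_pow, mul_pow]
    ring
  simpa using le_hasSum h 0 fun n _ => by positivity

/-- This is conditional Jensen for the martingale `tiltLR`. -/
theorem sq_tiltLR_le (w : ℝ) {m k : ℕ} (hk : k ≤ m) (s : ℝ) :
    tiltLR w k s ^ 2 ≤ tiltSq w m k s := by
  have hr : (0 : ℝ) ≤ m - k := by simpa using hk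
  have := sq_sum_le_sum_mul_exp (fun i => (![-1, 3, -3, 1] : Fin 4 → ℝ) i *
    expLR k s ((![-3, -1, 1, 3] : Fin 4 → ℝ) i * w))
    (fun i => (![-3, -1, 1, 3] : Fin 4 → ℝ) i * w) hr
  convert this using 1
  · simp [tiltLR, Fin.sum_univ_four]
    ring
  · unfold tiltSq
    refine Finset.sum_congr rfl fun i _ => Finset.sum_congr rfl fun j _ => ?_
    ring

theorem integrable_exp_affine (a b : ℝ) :
    Integrable (fun t => Real.exp (b + a * t)) (gaussianReal 0 1) := by
  simp_rw [Real.exp_add]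
  exact (integrable_exp_mul_gaussianReal a).const_mul _

theorem integral_exp_affine (a b : ℝ) :
    ∫ t, Real.exp (b + a * t) ∂gaussianReal 0 1 = Real.exp (b + a ^ 2 / 2) := by
  simp_rw [Real.exp_add]
  rw [integral_const_mul]
  have := congrFun (mgf_id_gaussianReal (μ := 0) (v := 1)) a
  simp only [mgf, id, zero_mul, NNReal.coe_one, one_mul, zero_add] at this
  rw [this]

/-- For each pair of atoms `x`, `y`, the Gaussian mean `exp ((x + y)² / 2)` cancels the quadratic
terms of the new observation and leaves `exp (x y)`, turning `m - (k + 1)` into `m - k`. -/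
theorem lintegral_tiltSq_succ (w : ℝ) {a : ℝ} (ha : 0 ≤ a) {m k : ℕ} (hk : k + 1 ≤ m) (s : ℝ) :
    ∫⁻ t, ENNReal.ofReal (a * tiltSq w m (k + 1) (s + t)) ∂gaussianReal 0 1 =
      ENNReal.ofReal (a * tiltSq w m k s) := by
  have hterm (x y t : ℝ) : expLR (k + 1) (s + t) x * expLR (k + 1) (s + t) y *
      Real.exp ((m - (k + 1 : ℕ)) * (x * y)) =
      Real.exp (x * s + y * s - (k + 1) * x ^ 2 / 2 - (k + 1) * y ^ 2 / 2 +
        (m - (k + 1)) * (x * y) + (x + y) * t) := by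
    rw [expLR, expLR, ← Real.exp_add, ← Real.exp_add]
    congr 1; push_cast; ring
  have hI (x y : ℝ) : ∫ t, expLR (k + 1) (s + t) x * expLR (k + 1) (s + t) y *
      Real.exp ((m - (k + 1 : ℕ)) * (x * y)) ∂gaussianReal 0 1 =
      expLR k s x * expLR k s y * Real.exp ((m - k) * (x * y)) := by
    simp_rw [hterm]
    rw [integral_exp_affine, expLR, expLR, ← Real.exp_add, ← Real.exp_add]
    congr 1; ring
  have hint (x y : ℝ) : Integrable (fun t => expLR (k + 1) (s + t) x * expLR (k + 1) (s + t) y *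
      Real.exp ((m - (k + 1 : ℕ)) * (x * y))) (gaussianReal 0 1) := by
    simp_rw [hterm]
    exact integrable_exp_affine _ _
  rw [← ofReal_integral_eq_lintegral_ofReal]
  · congr 1
    unfold tiltSq
    rw [integral_const_mul, integral_finsetSum]
    · congr 1
      refine Finset.sum_congr rfl fun i _ => ?_
      rw [integral_finsetSum]
      · refine Finset.sum_congr rfl fun j _ => ?_
        rw [integral_const_mul, hI]
      · exact fun j _ => (hint _ _).const_mul _
    · exact fun i _ => integrable_finsetSum _ fun j _ => (hint _ _).const_mul _
  · exact Integrable.const_mul (integrable_finsetSum _ fun i _ =>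
      integrable_finsetSum _ fun j _ => (hint _ _).const_mul _) _
  · exact ae_of_all _ fun t => mul_nonneg ha ((sq_nonneg _).trans (sq_tiltLR_le w hk _))

/-- The matched moments pay off here: the bound is cubic in `u = m w²`. Triple-angle formulas reduce
the double sum to `16 (sinh³ 3u - 3 sinh³ u)`, and `sinh 3u ≤ 6u` gives `16 · 6³ = 3456`. -/
theorem tiltSq_zero_le (w : ℝ) {m : ℕ} (hm : m * w ^ 2 ≤ 1 / 9) :
    tiltSq w m 0 0 ≤ 3456 * (m * w ^ 2) ^ 3 := by
  set u : ℝ := m * w ^ 2 with hu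
  have hu0 : 0 ≤ u := by positivity
  have h1 : tiltSq w m 0 0 = 16 * (Real.sinh (3 * u) ^ 3 - 3 * Real.sinh u ^ 3) := by
    have h9 : Real.sinh (9 * u) = 4 * Real.sinh (3 * u) ^ 3 + 3 * Real.sinh (3 * u) := by
      rw [← Real.sinh_three_mul]; congr 1; ring
    have h3 : Real.sinh (3 * u) = 4 * Real.sinh u ^ 3 + 3 * Real.sinh u := Real.sinh_three_mul u
    have h0 : tiltSq w m 0 0 =
        4 * (Real.sinh (9 * u) - 6 * Real.sinh (3 * u) + 9 * Real.sinh u) := by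
      simp only [tiltSq, Fin.sum_univ_four, expLR, Real.sinh_eq]
      simp
      have e1 : (m : ℝ) * (3 * w * (3 * w)) = 9 * u := by rw [hu]; ring
      have e2 : (m : ℝ) * (3 * w * w) = 3 * u := by rw [hu]; ring
      have e3 : (m : ℝ) * (w * (3 * w)) = 3 * u := by rw [hu]; ring
      have e4 : (m : ℝ) * (w * w) = u := by rw [hu]; ring
      rw [e1, e2, e3, e4]
      ring
    rw [h0, h9]
    linear_combination (-12) * h3
  have h2 : 0 ≤ Real.sinh u := Real.sinh_nonneg_iff.2 hu0
  have h3 : 0 ≤ Real.sinh (3 * u) := Real.sinh_nonneg_iff.2 (by linarith)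
  have h4 : Real.sinh (3 * u) ≤ 6 * u := by
    have a1 := (abs_le.1 (Real.abs_exp_sub_one_sub_id_le (x := 3 * u)
      (by rw [abs_of_nonneg (by linarith)]; linarith))).2
    have a2 := Real.add_one_le_exp (-(3 * u))
    rw [Real.sinh_eq]
    nlinarith
  have h5 : Real.sinh (3 * u) ^ 3 ≤ (6 * u) ^ 3 := by gcongr
  have h6 : 0 ≤ Real.sinh u ^ 3 := by positivity
  rw [h1]
  nlinarith

/-! ### The dominating supermartingale. -/

/-- A supermartingale (in the observations of a single point, and up to normalisation) which
dominates the `χ²` likelihood ratio of `tiltedMeasure c w q δ` and `tiltedMeasure c w q 0`. -/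
noncomputable def tiltWeight (c w q δ : ℝ) (m k : ℕ) (s : ℝ) : ℝ≥0∞ :=
  if k ≤ m then
    pointLR (tiltedMeasure c w q (2 * δ)) k s + ENNReal.ofReal (4 * δ ^ 2 * q ^ 2 * tiltSq w m k s)
  else
    (pointLR (tiltedMeasure c w q (2 * δ)) k s +
      ENNReal.ofReal (δ ^ 2) * pointLR (tiltedMeasure c w q 0) k s) *
        (1 + ENNReal.ofReal (4 * δ ^ 2))⁻¹

section

variable {c w q δ : ℝ}

theorem measurable_tiltWeight (hc : 0 < c) (hw : 0 < w) (hq : 0 < q)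
    (h : 8 * q + 2 * c * w = 1) (hδ0 : 0 ≤ δ) (hδ : δ ≤ 1 / 4) (m k : ℕ) :
    Measurable (tiltWeight c w q δ m k) := by
  have h2 := measurable_pointLR
    (tiltedLaw hc hw hq h (by linarith : 0 ≤ 2 * δ) (by linarith)) k
  have h0 := measurable_pointLR (tiltedLaw hc hw hq h le_rfl zero_le_one) k
  have h3 : Measurable (tiltSq w m k) := by unfold tiltSq expLR; fun_prop
  unfold tiltWeight
  split_ifs
  · exact h2.add (by fun_prop)
  · exact (h2.add (h0.const_mul _)).mul_const _

theorem half_base_le (hc : 0 < c) (hq : 0 < q) (hδ0 : 0 ≤ δ) (hδ : δ ≤ 1 / 4) (k : ℕ) (s : ℝ) :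
    baseLR c w q k s / 2 ≤ baseLR c w q k s + 2 * δ * q * tiltLR w k s := by
  have h1 := abs_tiltLR_le (w := w) hc hq k s
  have h2 := (abs_le.1 h1).1
  nlinarith [(abs_nonneg _).trans h1]

/-- On either side of the threshold the weight is built from martingales, with equality; only the
passage from `k = m` to `m + 1` can lose. -/
theorem lintegral_tiltWeight_succ_le (hc : 0 < c) (hw : 0 < w) (hq : 0 < q)
    (h : 8 * q + 2 * c * w = 1) (hδ0 : 0 ≤ δ) (hδ : δ ≤ 1 / 4) (m k : ℕ) (s : ℝ) :
    ∫⁻ t, tiltWeight c w q δ m (k + 1) (s + t) ∂gaussianReal 0 1 ≤ tiltWeight c w q δ m k s := by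
  have p2 := isProbabilityMeasure_tiltedMeasure hc hw hq h (by linarith : 0 ≤ 2 * δ) (by linarith)
  have p0 := isProbabilityMeasure_tiltedMeasure hc hw hq h le_rfl zero_le_one
  have hm (d : ℝ) (hd0 : 0 ≤ d) (hd : d ≤ 1) :
      Measurable fun t => pointLR (tiltedMeasure c w q d) (k + 1) (s + t) :=
    (measurable_pointLR (tiltedLaw hc hw hq h hd0 hd) (k + 1)).comp (by fun_prop)
  have hm2 := hm (2 * δ) (by linarith) (by linarith)
  have hm0 := hm 0 le_rfl zero_le_one
  by_cases hk : k + 1 ≤ m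
  · simp only [tiltWeight, hk, (Nat.le_succ k).trans hk, if_true]
    rw [lintegral_add_left hm2, lintegral_pointLR_succ, lintegral_tiltSq_succ w (by positivity) hk]
  · have hheavy : ∫⁻ t, tiltWeight c w q δ m (k + 1) (s + t) ∂gaussianReal 0 1 =
        (pointLR (tiltedMeasure c w q (2 * δ)) k s +
          ENNReal.ofReal (δ ^ 2) * pointLR (tiltedMeasure c w q 0) k s) *
            (1 + ENNReal.ofReal (4 * δ ^ 2))⁻¹ := by
      simp only [tiltWeight, hk, if_false]
      have hmh : Measurable fun t => pointLR (tiltedMeasure c w q (2 * δ)) (k + 1) (s + t) +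
          ENNReal.ofReal (δ ^ 2) * pointLR (tiltedMeasure c w q 0) (k + 1) (s + t) :=
        hm2.add (hm0.const_mul _)
      rw [lintegral_mul_const _ hmh, lintegral_add_left hm2,
        lintegral_const_mul _ hm0, lintegral_pointLR_succ, lintegral_pointLR_succ]
    rw [hheavy]
    by_cases hk' : k ≤ m
    · simp only [tiltWeight, hk', if_true]
      -- At `k = m` the `tiltSq` term is discarded. The new term `δ² * baseLR` is paid for by the
      -- factor `(1 + 4δ²)⁻¹`, since the likelihood with tilt `2δ` is at least `baseLR / 2`.
      refine le_trans ?_ le_self_add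
      have hb := half_base_le (w := w) hc hq hδ0 hδ k s
      have hb0 : 0 ≤ baseLR c w q k s := (abs_nonneg _).trans (abs_tiltLR_le hc hq k s)
      rw [← div_eq_mul_inv]
      refine ENNReal.div_le_of_le_mul ?_
      rw [pointLR_tiltedMeasure hc hq (by linarith) (by linarith),
        pointLR_tiltedMeasure hc hq le_rfl zero_le_one, ← ENNReal.ofReal_one,
        ← ENNReal.ofReal_add zero_le_one (by positivity), ← ENNReal.ofReal_mul (by positivity),
        ← ENNReal.ofReal_mul (by linarith), ← ENNReal.ofReal_add (by linarith)
          (mul_nonneg (by positivity) (by simpa using hb0))]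
      refine ENNReal.ofReal_le_ofReal ?_
      nlinarith [mul_le_mul_of_nonneg_left hb (sq_nonneg δ)]
    · simp only [tiltWeight, hk', if_false, le_refl]

/-- With `B = baseLR` and `T = q * tiltLR`, `(B + δT)² = B (B + 2δT) + δ² T²`, which explains the
tilt `2δ` in the weight. For `k ≤ m` the remainder is controlled by `B ≥ 1/4` and `tiltSq`, for `k >
m` by `|T| ≤ B`. -/
theorem sq_pointLR_le (hc : 0 < c) (hq : 1 / 16 ≤ q) (hδ0 : 0 ≤ δ) (hδ : δ ≤ 1 / 4) {m : ℕ}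
    (hm : m * w ^ 2 ≤ 1 / 9) (k : ℕ) (s : ℝ) :
    pointLR (tiltedMeasure c w q δ) k s ^ 2 ≤
      (if m < k then 1 + ENNReal.ofReal (4 * δ ^ 2) else 1) * tiltWeight c w q δ m k s *
        pointLR (tiltedMeasure c w q 0) k s := by
  have hq0 : 0 < q := by linarith
  have hb := half_base_le (w := w) hc hq0 hδ0 hδ k s
  have habs := abs_tiltLR_le (w := w) hc hq0 k s
  have hb0 : 0 ≤ baseLR c w q k s := (abs_nonneg _).trans habs
  have h1 : 0 ≤ baseLR c w q k s + δ * q * tiltLR w k s := by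
    nlinarith [(abs_le.1 habs).1]
  by_cases hk : k ≤ m
  · have hk' : ¬ m < k := not_lt.2 hk
    have hE := sq_tiltLR_le w hk s
    have hD : 0 ≤ tiltSq w m k s := (sq_nonneg _).trans hE
    have hb4 := le_baseLR hc hq hk hm s
    simp only [tiltWeight, hk, hk', if_true, if_false, one_mul]
    rw [pointLR_tiltedMeasure hc hq0 hδ0 (by linarith),
      pointLR_tiltedMeasure hc hq0 (by linarith) (by linarith),
      pointLR_tiltedMeasure hc hq0 le_rfl zero_le_one, ← ENNReal.ofReal_pow h1,
      ← ENNReal.ofReal_add (by linarith) (by positivity),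
      ← ENNReal.ofReal_mul (add_nonneg (by linarith) (by positivity))]
    refine ENNReal.ofReal_le_ofReal ?_
    have h2 : tiltLR w k s ^ 2 ≤ tiltSq w m k s * (4 * baseLR c w q k s) := by nlinarith
    have h3 := mul_le_mul_of_nonneg_left h2 (by positivity : 0 ≤ δ ^ 2 * q ^ 2)
    nlinarith
  · have hk' : m < k := not_le.1 hk
    simp only [tiltWeight, hk, hk', if_true, if_false]
    have hκ : (1 + ENNReal.ofReal (4 * δ ^ 2)) * (1 + ENNReal.ofReal (4 * δ ^ 2))⁻¹ = 1 :=
      ENNReal.mul_inv_cancel (by simp)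
        (ENNReal.add_ne_top.2 ⟨ENNReal.one_ne_top, ENNReal.ofReal_ne_top⟩)
    rw [mul_comm (1 + ENNReal.ofReal (4 * δ ^ 2)), mul_assoc _ _ (1 + ENNReal.ofReal (4 * δ ^ 2)),
      mul_comm _ (1 + ENNReal.ofReal (4 * δ ^ 2)), hκ, mul_one,
      pointLR_tiltedMeasure hc hq0 hδ0 (by linarith),
      pointLR_tiltedMeasure hc hq0 (by linarith) (by linarith),
      pointLR_tiltedMeasure hc hq0 le_rfl zero_le_one, ← ENNReal.ofReal_pow h1, zero_mul, zero_mul,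
      add_zero, ← ENNReal.ofReal_mul (by positivity), ← ENNReal.ofReal_add (by linarith)
      (by positivity), ← ENNReal.ofReal_mul (add_nonneg (by linarith) (by positivity))]
    refine ENNReal.ofReal_le_ofReal ?_
    have h2 : (q * tiltLR w k s) ^ 2 ≤ baseLR c w q k s ^ 2 := sq_le_sq' (abs_le.1 habs).1 (abs_le.1 habs).2
    have h3 := mul_le_mul_of_nonneg_left h2 (sq_nonneg δ)
    nlinarith

theorem tiltWeight_zero (hc : 0 < c) (hw : 0 < w) (hq : 0 < q)
    (h : 8 * q + 2 * c * w = 1) (hδ0 : 0 ≤ δ) (hδ : δ ≤ 1 / 4) (m : ℕ) :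
    tiltWeight c w q δ m 0 0 = 1 + ENNReal.ofReal (4 * δ ^ 2 * q ^ 2 * tiltSq w m 0 0) := by
  have p2 := isProbabilityMeasure_tiltedMeasure hc hw hq h (by linarith : 0 ≤ 2 * δ) (by linarith)
  simp [tiltWeight, pointLR]

theorem tiltedLaw_obs_mem_le {S : Type*} [MeasurableSpace S] (π : OnlineAlgorithm S)
    (hc : 0 < c) (hw : 0 < w) (hq : 0 < q) (hq' : 1 / 16 ≤ q) (h : 8 * q + 2 * c * w = 1)
    (hδ0 : 0 ≤ δ) (hδ : δ ≤ 1 / 4) (hδ' : δ ≤ 1) {m : ℕ} (hm : m * w ^ 2 ≤ 1 / 9)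
    (n : ℕ) {A : Set (S × (Fin n → ℝ))} (hA : MeasurableSet A) :
    π.law (tiltedLaw hc hw hq h le_rfl zero_le_one) {ω | (ω.1, π.obs ω n) ∈ A} + 2 ≤
      π.law (tiltedLaw hc hw hq h hδ0 hδ') {ω | (ω.1, π.obs ω n) ∈ A} +
        (1 + ENNReal.ofReal (4 * δ ^ 2 * q ^ 2 * tiltSq w m 0 0)) ^ n *
          (1 + ENNReal.ofReal (4 * δ ^ 2)) ^ (n / (m + 1)) + ENNReal.ofReal (5 / 4) := by
  set C : ℝ≥0∞ := 1 + ENNReal.ofReal (4 * δ ^ 2 * q ^ 2 * tiltSq w m 0 0) with hC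
  have hC0 : C ≠ 0 := by simp [hC]
  have hCt : C ≠ ∞ := by simp [hC]
  have hCC : C * C⁻¹ = 1 := ENNReal.mul_inv_cancel hC0 hCt
  have hmeas := measurable_tiltWeight hc hw hq h hδ0 hδ m
  -- Dividing by the initial value `C` gives `w 0 0 = 1`; each queried point then pays a factor `C`.
  refine law_obs_mem_le π (w := fun k s => tiltWeight c w q δ m k s * C⁻¹) ?_ ?_ le_self_add
    le_self_add (fun k => (hmeas k).mul_const _) ?_ (fun k s => ?_) (fun k s => ?_) n hA
  · intro k s
    change pointLR (tiltedMeasure c w q 0) k s ≠ ∞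
    rw [pointLR_tiltedMeasure hc hq le_rfl zero_le_one]
    exact ENNReal.ofReal_ne_top
  · intro k s
    change pointLR (tiltedMeasure c w q δ) k s ≠ ∞
    rw [pointLR_tiltedMeasure hc hq hδ0 hδ']
    exact ENNReal.ofReal_ne_top
  · rw [tiltWeight_zero hc hw hq h hδ0 hδ, ← hC, hCC]
  · have hmt : Measurable fun t => tiltWeight c w q δ m (k + 1) (s + t) :=
      (hmeas (k + 1)).comp (by fun_prop)
    rw [lintegral_mul_const _ hmt]
    gcongr
    exact lintegral_tiltWeight_succ_le hc hw hq h hδ0 hδ m k s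
  · refine (sq_pointLR_le hc hq' hδ0 hδ hm k s).trans_eq ?_
    change _ = C * _ * (_ * C⁻¹) * pointLR (tiltedMeasure c w q 0) k s
    have (x y z : ℝ≥0∞) : C * x * (y * C⁻¹) * z = (C * C⁻¹) * (x * y * z) := by ring
    rw [this, hCC, one_mul]

end

/-! ### From indistinguishable laws to a sample bound. -/

section

variable {S : Type*} [MeasurableSpace S] (π : OnlineAlgorithm S)

/-- The first `n` entries of a vector, padded by `0`. -/
noncomputable def takeVec {N : ℕ} (n : ℕ) (y : Fin N → ℝ) : Fin n → ℝ :=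
  fun i => if h : i.1 < N then y ⟨i, h⟩ else 0

theorem measurable_takeVec {N : ℕ} (n : ℕ) : Measurable (takeVec (N := N) n) := by
  unfold takeVec
  refine measurable_pi_lambda _ fun i => ?_
  split_ifs <;> fun_prop

theorem takeVec_obs (ω : S × (ℕ → ℝ) × (ℕ → ℝ)) {n N : ℕ} (h : n ≤ N) :
    takeVec n (π.obs ω N) = π.obs ω n := by
  induction N, h using Nat.le_induction with
  | base => ext i; simp [takeVec]
  | succ N hN ih =>
    rw [← ih]
    ext i
    have h1 : i.1 < N := i.2.trans_le hN
    have h2 : (⟨i.1, h1.trans (Nat.lt_succ_self N)⟩ : Fin (N + 1)) = (⟨i.1, h1⟩ : Fin N).castSucc :=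
      rfl
    simp only [takeVec, h1, h1.trans (Nat.lt_succ_self N), dite_true, OnlineAlgorithm.obs]
    rw [h2, Fin.snoc_castSucc]

theorem numSamples_eq_iff (ω : S × (ℕ → ℝ) × (ℕ → ℝ)) (n : ℕ) :
    π.numSamples ω = n ↔ (ω.1, π.obs ω n) ∈ π.halt n ∧ ∀ j < n, (ω.1, π.obs ω j) ∉ π.halt j := by
  classical
  have key {n : ℕ} (h : (ω.1, π.obs ω n) ∈ π.halt n)
      (h' : ∀ j < n, (ω.1, π.obs ω j) ∉ π.halt j) : π.numSamples ω = n := by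
    refine le_antisymm (iInf₂_le n h) (le_iInf₂ fun k hk => ?_)
    exact_mod_cast not_lt.1 fun hkn => h' k hkn hk
  refine ⟨fun h => ?_, fun h => key h.1 h.2⟩
  by_cases hex : ∃ k, (ω.1, π.obs ω k) ∈ π.halt k
  · have h1 := key (Nat.find_spec hex) fun j hj => Nat.find_min hex hj
    rw [h] at h1
    have h2 : n = Nat.find hex := by exact_mod_cast h1
    rw [h2]
    exact ⟨Nat.find_spec hex, fun j hj => Nat.find_min hex hj⟩
  · push Not at hex
    have : π.numSamples ω = ⊤ := by
      simp [OnlineAlgorithm.numSamples, hex]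
    rw [this] at h
    exact absurd h.symm (ENat.natCast_ne_top n)

/-- If two laws with well separated target values cannot be told apart from the first `N`
observations, a PAC algorithm uses more than `N` samples with substantial probability. -/
theorem le_expectedSamples {μ₀ μ₁ : ProbabilityMeasure ℝ} {g₀ g₁ ε : ℝ}
    (h₀ : π.IsPAC μ₀ g₀ ε (1 / 10)) (h₁ : π.IsPAC μ₁ g₁ ε (1 / 10)) (hg : 2 * ε < |g₀ - g₁|)
    (N : ℕ) (hclose : ∀ A : Set (S × (Fin N → ℝ)), MeasurableSet A →
      π.law μ₀ {ω | (ω.1, π.obs ω N) ∈ A} + 2 ≤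
        π.law μ₁ {ω | (ω.1, π.obs ω N) ∈ A} + ENNReal.ofReal (53 / 20)) :
    ENNReal.ofReal ((N + 1) / 10) ≤ π.expectedSamples μ₀ := by
  have := π.isProbabilityMeasure_seedLaw
  have hlaw : π.law μ₀ Set.univ = 1 := by rw [OnlineAlgorithm.law]; simp
  have hhalt (n : ℕ) : MeasurableSet {p : S × (Fin N → ℝ) | (p.1, takeVec n p.2) ∈ π.halt n} :=
    (measurable_fst.prodMk ((measurable_takeVec n).comp measurable_snd)) (π.measurableSet_halt n)
  -- Stopping by time `N` with an output within `ε` of `g₀`, as an event of the first `N`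
  -- observations. As `n ≤ N`, the padding in `takeVec` is never read.
  set A : Set (S × (Fin N → ℝ)) := {p | ∃ n ≤ N, (p.1, takeVec n p.2) ∈ π.halt n ∧
    (∀ j < n, (p.1, takeVec j p.2) ∉ π.halt j) ∧
    |π.estimate n (p.1, takeVec n p.2) - g₀| ≤ ε} with hAdef
  have hA : MeasurableSet A := by
    have : A = ⋃ n, ⋃ (_ : n ≤ N), ({p : S × (Fin N → ℝ) | (p.1, takeVec n p.2) ∈ π.halt n} ∩
        ((⋂ j, ⋂ (_ : j < n), {p : S × (Fin N → ℝ) | (p.1, takeVec j p.2) ∈ π.halt j}ᶜ) ∩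
        {p | |π.estimate n (p.1, takeVec n p.2) - g₀| ≤ ε})) := by
      ext p
      simp only [hAdef, Set.mem_ofPred_eq, Set.mem_iUnion, Set.mem_inter_iff, Set.mem_iInter,
        Set.mem_compl_iff, exists_prop]
    rw [this]
    refine MeasurableSet.iUnion fun n => MeasurableSet.iUnion fun _ => (hhalt n).inter
      ((MeasurableSet.iInter fun j => MeasurableSet.iInter fun _ => (hhalt j).compl).inter ?_)
    have hm : Measurable fun p : S × (Fin N → ℝ) => π.estimate n (p.1, takeVec n p.2) :=
      (π.measurable_estimate n).comp
        (measurable_fst.prodMk ((measurable_takeVec n).comp measurable_snd))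
    exact measurableSet_le ((hm.sub_const g₀).abs) measurable_const
  set B : Set (S × (ℕ → ℝ) × (ℕ → ℝ)) := {ω | ∀ n ≤ N, (ω.1, π.obs ω n) ∉ π.halt n} with hBdef
  have hB : MeasurableSet B := by
    have : B = ⋂ n, ⋂ (_ : n ≤ N), ((fun ω => (ω.1, π.obs ω n)) ⁻¹' π.halt n)ᶜ := by
      ext ω; simp [hBdef]
    rw [this]
    exact MeasurableSet.iInter fun n => MeasurableSet.iInter fun _ =>
      ((measurable_fst.prodMk (measurable_obs π n)) (π.measurableSet_halt n)).compl
  by_contra! hlt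
  -- Markov's inequality: on `B` at least `N + 1` samples are taken.
  have hPB : π.law μ₀ B ≤ ENNReal.ofReal (1 / 10) := by
    have h1 : ENNReal.ofReal (N + 1) * π.law μ₀ B ≤ π.expectedSamples μ₀ := by
      rw [← lintegral_indicator_const hB]
      refine lintegral_mono fun ω => ?_
      by_cases hω : ω ∈ B
      · rw [Set.indicator_of_mem hω]
        have h2 : ((N + 1 : ℕ) : ℕ∞) ≤ π.numSamples ω := by
          refine le_iInf₂ fun k hk => ?_
          exact_mod_cast not_le.1 fun hkN => hω k hkN hk
        have h3 : (((N + 1 : ℕ) : ℕ∞) : ℝ≥0∞) ≤ (π.numSamples ω : ℝ≥0∞) :=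
          ENat.toENNReal_le.2 h2
        refine le_trans (le_of_eq ?_) h3
        rw [ENat.toENNReal_coe, ← ENNReal.ofReal_natCast]
        push_cast; rfl
      · simp [Set.indicator_of_notMem hω]
    have h2 := h1.trans hlt.le
    rw [div_eq_mul_one_div, ENNReal.ofReal_mul (by positivity)] at h2
    exact (ENNReal.mul_le_mul_iff_right (by simp; positivity) ENNReal.ofReal_ne_top).1 h2
  have hcover : (Set.univ : Set (S × (ℕ → ℝ) × (ℕ → ℝ))) ⊆ {ω | (ω.1, π.obs ω N) ∈ A} ∪
      ({ω | ¬ ∃ n : ℕ, π.numSamples ω = n ∧ |π.estimate n (ω.1, π.obs ω n) - g₀| ≤ ε} ∪ B) := by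
    intro ω _
    by_cases hω : ∃ n : ℕ, π.numSamples ω = n ∧ |π.estimate n (ω.1, π.obs ω n) - g₀| ≤ ε
    · obtain ⟨n, hn, he⟩ := hω
      rw [numSamples_eq_iff] at hn
      by_cases hnN : n ≤ N
      · refine Or.inl ⟨n, hnN, ?_, fun j hj => ?_, ?_⟩
        · rw [takeVec_obs π ω hnN]; exact hn.1
        · rw [takeVec_obs π ω (hj.le.trans hnN)]; exact hn.2 j hj
        · rw [takeVec_obs π ω hnN]; exact he
      · exact Or.inr (Or.inr fun k hk => hn.2 k (hk.trans_lt (not_le.1 hnN)))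
    · exact Or.inr (Or.inl hω)
  have hA1 : π.law μ₁ {ω | (ω.1, π.obs ω N) ∈ A} ≤ ENNReal.ofReal (1 / 10) := by
    refine le_trans (measure_mono ?_) h₁
    rintro ω ⟨n, hnN, hn1, hn2, hn3⟩ ⟨n', hn', he'⟩
    have hn : π.numSamples ω = n := by
      rw [numSamples_eq_iff]
      rw [takeVec_obs π ω hnN] at hn1
      exact ⟨hn1, fun j hj => by rw [← takeVec_obs π ω (hj.le.trans hnN)]; exact hn2 j hj⟩
    have hnn : n = n' := by
      rw [hn] at hn'; exact_mod_cast hn'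
    subst hnn
    rw [takeVec_obs π ω hnN] at hn3
    have h1 := abs_sub_le g₀ (π.estimate n (ω.1, π.obs ω n)) g₁
    rw [abs_sub_comm g₀ (π.estimate n _)] at h1
    have hn4 : |π.estimate n (ω.1, π.obs ω n) - g₀| ≤ ε := hn3
    linarith
  have h1 : (1 : ℝ≥0∞) ≤ π.law μ₀ {ω | (ω.1, π.obs ω N) ∈ A} +
      (ENNReal.ofReal (1 / 10) + ENNReal.ofReal (1 / 10)) := by
    rw [← hlaw]
    refine (measure_mono hcover).trans ((measure_union_le _ _).trans ?_)
    gcongr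
    exact (measure_union_le _ _).trans (add_le_add h₀ hPB)
  -- The contradiction is `3 ≤ 0.1 + 2.65 + 0.1 + 0.1 = 2.95`.
  have h2 : (1 : ℝ≥0∞) + 2 ≤ ENNReal.ofReal (1 / 10) + ENNReal.ofReal (53 / 20) +
      (ENNReal.ofReal (1 / 10) + ENNReal.ofReal (1 / 10)) := by
    calc (1 : ℝ≥0∞) + 2 ≤ π.law μ₀ {ω | (ω.1, π.obs ω N) ∈ A} +
          (ENNReal.ofReal (1 / 10) + ENNReal.ofReal (1 / 10)) + 2 := by gcongr
      _ = π.law μ₀ {ω | (ω.1, π.obs ω N) ∈ A} + 2 +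
          (ENNReal.ofReal (1 / 10) + ENNReal.ofReal (1 / 10)) := by ring
      _ ≤ _ := add_le_add ((hclose A hA).trans (add_le_add hA1 le_rfl)) le_rfl
  have e : (1 : ℝ≥0∞) + 2 = ENNReal.ofReal 3 := by
    rw [ENNReal.ofReal_ofNat]; norm_num
  rw [e, ← ENNReal.ofReal_add (by norm_num) (by norm_num), ← ENNReal.ofReal_add (by norm_num)
    (by norm_num), ← ENNReal.ofReal_add (by norm_num) (by norm_num),
    ENNReal.ofReal_le_ofReal_iff (by norm_num)] at h2
  norm_num at h2

end

/-! ### Choice of scales. -/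

theorem eventually_mul_rpow_le (K : ℝ) {p a : ℝ} (hp : 0 < p) (ha : 0 < a) :
    ∀ᶠ ε : ℝ in 𝓝[>] 0, K * ε ^ p ≤ a := by
  have h : Tendsto (fun ε : ℝ => K * ε ^ p) (𝓝[>] 0) (𝓝 (K * 0)) := by
    refine Tendsto.const_mul K ?_
    have := (Real.continuousAt_rpow_const 0 p (Or.inr hp.le)).tendsto
    rw [Real.zero_rpow hp.ne'] at this
    exact this.mono_left nhdsWithin_le_nhds
  rw [mul_zero] at h
  exact (h.eventually_lt_const ha).mono fun _ h => h.le

theorem LessApprox.eventually_le {r : ℝ → ℝ} {s t b : ℝ} (hr : LessApprox r fun ε => ε ^ s)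
    (ht : t < s) (hb : 0 < b) : ∀ᶠ ε : ℝ in 𝓝[>] 0, r ε ≤ b * ε ^ t := by
  -- Half of the gap `s - t` is spent on the factor `ε ^ (-c)`, the other half absorbs `K` and `b`.
  obtain ⟨K, hK⟩ := (hr ((s - t) / 2) (by linarith)).bound
  filter_upwards [hK, eventually_mul_rpow_le K (p := (s - t) / 2) (by linarith) hb,
    self_mem_nhdsWithin] with ε h1 h2 h3
  have hε : 0 < ε := h3
  calc r ε ≤ ‖r ε‖ := Real.le_norm_self _
    _ ≤ K * ‖ε ^ (-((s - t) / 2)) * ε ^ s‖ := h1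
    _ = K * ε ^ ((s - t) / 2) * ε ^ t := by
        rw [← Real.rpow_add hε, Real.norm_of_nonneg (by positivity), mul_assoc, ← Real.rpow_add hε]
        congr 2; ring
    _ ≤ b * ε ^ t := by gcongr

theorem one_add_ofReal_pow_le {x : ℝ} (hx : 0 ≤ x) (n : ℕ) :
    (1 + ENNReal.ofReal x) ^ n ≤ ENNReal.ofReal (Real.exp (n * x)) := by
  rw [← ENNReal.ofReal_one, ← ENNReal.ofReal_add zero_le_one hx,
    ← ENNReal.ofReal_pow (by positivity), Real.exp_nat_mul]
  gcongr
  linarith [Real.add_one_le_exp x]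

/-- The conditions under which the tilted laws give a lower bound. -/
theorem exists_expectedSamples_ge {c c₂ r₁ r₂ ε w : ℝ} (hc : 0 < c) (hc₂ : 0 ≤ c₂) (hε : 0 < ε)
    (hw : 0 < w) (hcw : c * w ≤ 1 / 4) (hεw : 3 * ε ≤ w / 4) (hr₁ : r₁ ≤ w / 4) (hr₂ : r₂ ≤ w / 4)
    (hcε : 24 * c * ε ≤ 1 / 4) {m n : ℕ} (hm : m * w ^ 2 ≤ 1 / 9)
    (hn₁ : 124416 * c ^ 2 * (n * ε ^ 2 * (m * w ^ 2) ^ 3) ≤ 1 / 8)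
    (hn₂ : 2304 * c ^ 2 * (ε ^ 2 * (n / (m + 1))) ≤ 1 / 8) {S : Type*} [MeasurableSpace S]
    (π : OnlineAlgorithm S)
    (hπ : ∀ μ ∈ medianClass c c₂ r₁ r₂, π.IsPAC μ (median μ) ε (1 / 10)) :
    ∃ μ ∈ medianClass c c₂ r₁ r₂, ENNReal.ofReal ((n + 1) / 10) ≤ π.expectedSamples μ := by
  set q : ℝ := (1 - 2 * c * w) / 8 with hqdef
  have hq' : 1 / 16 ≤ q := by rw [hqdef]; linarith
  have hq : 0 < q := by linarith
  have hq8 : q ≤ 1 / 8 := by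
    have := mul_pos hc hw
    rw [hqdef]; linarith
  have h : 8 * q + 2 * c * w = 1 := by rw [hqdef]; ring
  -- The shift `2qδ` of `F` against slope `c` moves the median by `3ε`, more than the `2ε` needed
  -- for separation.
  set δ : ℝ := 3 * ε * c / (2 * q) with hδdef
  have hδ0 : 0 ≤ δ := by positivity
  have hδq : 2 * q * δ = 3 * ε * c := by rw [hδdef]; field_simp
  have hδε : δ ≤ 24 * c * ε := by
    rw [hδdef, div_le_iff₀ (by positivity)]
    nlinarith [mul_pos hc hε]
  have hδ : δ ≤ 1 / 4 := hδε.trans hcε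
  have hδ1 : δ ≤ 1 := by linarith
  set μ₀ := tiltedLaw hc hw hq h le_rfl zero_le_one
  set μ₁ := tiltedLaw hc hw hq h hδ0 hδ1
  have hg₀ : (0 : ℝ) ∈ Set.Ioo (-w) w := ⟨by linarith, hw⟩
  have hg₁ : -(3 * ε) ∈ Set.Ioo (-w) w := ⟨by linarith, by linarith⟩
  have hF₀ : ∀ x ∈ Set.Ioo (-w) w, cdf (μ₀ : Measure ℝ) x = 1 / 2 + c * (x - 0) := by
    intro x hx
    refine (cdf_tiltedMeasure hc hw hq h le_rfl zero_le_one hx).trans ?_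
    ring
  have hF₁ : ∀ x ∈ Set.Ioo (-w) w, cdf (μ₁ : Measure ℝ) x = 1 / 2 + c * (x - -(3 * ε)) := by
    intro x hx
    refine (cdf_tiltedMeasure hc hw hq h hδ0 hδ1 hx).trans ?_
    linear_combination hδq
  have hmem₀ : μ₀ ∈ medianClass c c₂ r₁ r₂ :=
    mem_medianClass_of_cdf hc hc₂ (by simp; linarith) (by simp; linarith) hg₀ hF₀
  have habs : |-(3 * ε)| = 3 * ε := by rw [abs_neg, abs_of_pos (by linarith)]
  have hmem₁ : μ₁ ∈ medianClass c c₂ r₁ r₂ :=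
    mem_medianClass_of_cdf hc hc₂ (by rw [habs]; linarith) (by rw [habs]; linarith) hg₁ hF₁
  refine ⟨μ₀, hmem₀, le_expectedSamples π (hπ μ₀ hmem₀) (hπ μ₁ hmem₁) ?_ n fun A hA => ?_⟩
  · rw [median_eq_of_cdf hc hg₀ hF₀, median_eq_of_cdf hc hg₁ hF₁, zero_sub, neg_neg,
      abs_of_pos (by linarith)]
    linarith
  · refine (tiltedLaw_obs_mem_le π hc hw hq hq' h hδ0 hδ hδ1 hm n hA).trans ?_
    have hδsq : δ ^ 2 ≤ 576 * c ^ 2 * ε ^ 2 := by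
      calc δ ^ 2 ≤ (24 * c * ε) ^ 2 := by gcongr
        _ = _ := by ring
    have hq2 : q ^ 2 ≤ 1 / 64 := by nlinarith
    have hT0 : 0 ≤ tiltSq w m 0 0 := (sq_nonneg _).trans (sq_tiltLR_le w (Nat.zero_le m) 0)
    have hT := tiltSq_zero_le w hm
    have b1 : n * (4 * δ ^ 2 * q ^ 2 * tiltSq w m 0 0) ≤ 1 / 8 := by
      calc n * (4 * δ ^ 2 * q ^ 2 * tiltSq w m 0 0)
          ≤ n * (4 * (576 * c ^ 2 * ε ^ 2) * (1 / 64) * (3456 * (m * w ^ 2) ^ 3)) := by gcongr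
        _ = 124416 * c ^ 2 * (n * ε ^ 2 * (m * w ^ 2) ^ 3) := by ring
        _ ≤ _ := hn₁
    have b2 : ((n / (m + 1) : ℕ) : ℝ) * (4 * δ ^ 2) ≤ 1 / 8 := by
      have : ((n / (m + 1) : ℕ) : ℝ) ≤ n / (m + 1) := by
        simpa using Nat.cast_div_le (α := ℝ) (m := n) (n := m + 1)
      calc ((n / (m + 1) : ℕ) : ℝ) * (4 * δ ^ 2)
          ≤ (n / (m + 1)) * (4 * (576 * c ^ 2 * ε ^ 2)) := by gcongr
        _ = 2304 * c ^ 2 * (ε ^ 2 * (n / (m + 1))) := by ring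
        _ ≤ _ := hn₂
    -- The two exponents add up to at most `1/4`, and `exp (1/4) ≤ 1 + 1/4 + 1/16 < 7/5`; then `7/5
    -- + 5/4 = 53/20`.
    have b3 : (1 + ENNReal.ofReal (4 * δ ^ 2 * q ^ 2 * tiltSq w m 0 0)) ^ n *
        (1 + ENNReal.ofReal (4 * δ ^ 2)) ^ (n / (m + 1)) ≤ ENNReal.ofReal (7 / 5) := by
      refine (mul_le_mul' (one_add_ofReal_pow_le (by positivity) n)
        (one_add_ofReal_pow_le (by positivity) _)).trans ?_
      rw [← ENNReal.ofReal_mul (Real.exp_pos _).le, ← Real.exp_add]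
      refine ENNReal.ofReal_le_ofReal ?_
      have e1 := Real.exp_le_exp.2 (add_le_add b1 b2)
      have e2 := (abs_le.1 (Real.abs_exp_sub_one_sub_id_le (x := 1 / 8 + 1 / 8)
        (by norm_num))).2
      exact e1.trans (by norm_num at e2 ⊢; linarith)
    rw [add_assoc]
    refine add_le_add le_rfl ((add_le_add b3 le_rfl).trans_eq ?_)
    rw [← ENNReal.ofReal_add (by norm_num) (by norm_num)]
    norm_num

theorem mainTheorem1 (θ : ℝ) (hθ : 0 < θ) (c₁ c₂ : ℝ) (hc₁ : 0 < c₁) (hc₂ : 0 < c₂)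
    (r₁ r₂ : ℝ → ℝ) (hr₁_pos : ∀ ε, 0 < ε → 0 < r₁ ε) (hr₂_pos : ∀ ε, 0 < ε → 0 < r₂ ε)
    (hr₁ : LessApprox r₁ fun ε => ε) (hr₂ : LessApprox r₂ fun ε => √ε) :
    ∃ C : ℝ, 0 < C ∧ ∃ ε₀ : ℝ, 0 < ε₀ ∧ ∀ ε : ℝ, 0 < ε → ε < ε₀ →
      ∀ (S : Type*) [MeasurableSpace S] (π : OnlineAlgorithm S),
        (∀ μ ∈ medianClass c₁ c₂ (r₁ ε) (r₂ ε), π.IsPAC μ (median μ) ε (1 / 10)) →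
          ∃ μ ∈ medianClass c₁ c₂ (r₁ ε) (r₂ ε),
            ENNReal.ofReal (C * ε ^ (-(5 / 2) + θ)) ≤ π.expectedSamples μ := by
  have hr₁' : LessApprox r₁ fun ε => ε ^ (1 : ℝ) := by simpa using hr₁
  have hr₂' : LessApprox r₂ fun ε => ε ^ (1 / 2 : ℝ) := by simpa [Real.sqrt_eq_rpow] using hr₂
  -- The construction reaches `ε^(-5/2) / 10` itself; `θ` only weakens the bound at the end.
  refine ⟨1 / 10, by norm_num, ?_⟩
  -- The width is `w = ε^(7/16)`: since `7/16 < 1/2`, it eventually dominates `r₁`, `r₂` and `ε`.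
  have hev : ∀ᶠ ε : ℝ in 𝓝[>] 0, (ε ≤ 1 ∧ c₁ * ε ^ (7 / 16 : ℝ) ≤ 1 / 4 ∧
      3 * ε ≤ ε ^ (7 / 16 : ℝ) / 4 ∧ r₁ ε ≤ ε ^ (7 / 16 : ℝ) / 4 ∧ r₂ ε ≤ ε ^ (7 / 16 : ℝ) / 4 ∧
      24 * c₁ * ε ≤ 1 / 4 ∧ ε ^ (1 / 4 : ℝ) ≤ 1 / 9 ∧
      124416 * c₁ ^ 2 * ε ^ (1 / 4 : ℝ) ≤ 1 / 8 ∧ 2304 * c₁ ^ 2 * ε ^ (1 / 8 : ℝ) ≤ 1 / 8) := by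
    have q := @eventually_mul_rpow_le
    filter_upwards [q 1 zero_lt_one zero_lt_one, q c₁ (p := 7 / 16) (by norm_num)
        (by norm_num : (0 : ℝ) < 1 / 4), q 3 (p := 9 / 16) (by norm_num)
        (by norm_num : (0 : ℝ) < 1 / 4), hr₁'.eventually_le (t := 7 / 16) (by norm_num)
        (by norm_num : (0 : ℝ) < 1 / 4), hr₂'.eventually_le (t := 7 / 16) (by norm_num)
        (by norm_num : (0 : ℝ) < 1 / 4), q (24 * c₁) zero_lt_one (by norm_num : (0 : ℝ) < 1 / 4),
        q 1 (p := 1 / 4) (by norm_num) (by norm_num : (0 : ℝ) < 1 / 9),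
        q (124416 * c₁ ^ 2) (p := 1 / 4) (by norm_num) (by norm_num : (0 : ℝ) < 1 / 8),
        q (2304 * c₁ ^ 2) (p := 1 / 8) (by norm_num) (by norm_num : (0 : ℝ) < 1 / 8),
        self_mem_nhdsWithin]
      with ε h1 h2 h3 h4 h5 h6 h7 h8 h9 hpos
    have hε : 0 < ε := hpos
    rw [Real.rpow_one] at h1 h6
    refine ⟨by linarith, h2, ?_, by linarith, by linarith, h6, by linarith, h8, h9⟩
    have : ε = ε ^ (9 / 16 : ℝ) * ε ^ (7 / 16 : ℝ) := by
      rw [← Real.rpow_add hε]; norm_num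
    calc 3 * ε = 3 * ε ^ (9 / 16 : ℝ) * ε ^ (7 / 16 : ℝ) := by rw [mul_assoc, ← this]
      _ ≤ 1 / 4 * ε ^ (7 / 16 : ℝ) := by gcongr
      _ = _ := by ring
  obtain ⟨ε₀, hε₀, hsub⟩ := mem_nhdsGT_iff_exists_Ioo_subset.1 hev
  refine ⟨ε₀, hε₀, fun ε hε hlt S _ π hπ => ?_⟩
  obtain ⟨h1, h2, h3, h4, h5, h6, h7, h8, h9⟩ := hsub ⟨hε, hlt⟩
  -- With these scales `m w² ≤ ε^(1/4)`; the two cost terms are at most `ε^(-1/2 + 3/4) = ε^(1/4)`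
  -- and `ε^(-1/2 + 5/8) = ε^(1/8)`, up to constants.
  set m := ⌊ε ^ (-(5 / 8) : ℝ)⌋₊ with hm
  set n := ⌊ε ^ (-(5 / 2) : ℝ)⌋₊ with hn
  have hm1 : (m : ℝ) ≤ ε ^ (-(5 / 8) : ℝ) := Nat.floor_le (by positivity)
  have hm2 : ε ^ (-(5 / 8) : ℝ) ≤ m + 1 := (Nat.lt_floor_add_one _).le
  have hn1 : (n : ℝ) ≤ ε ^ (-(5 / 2) : ℝ) := Nat.floor_le (by positivity)
  have hn2 : ε ^ (-(5 / 2) : ℝ) ≤ n + 1 := (Nat.lt_floor_add_one _).le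
  have hmw : m * (ε ^ (7 / 16 : ℝ)) ^ 2 ≤ ε ^ (1 / 4 : ℝ) := by
    calc m * (ε ^ (7 / 16 : ℝ)) ^ 2 ≤ ε ^ (-(5 / 8) : ℝ) * (ε ^ (7 / 16 : ℝ)) ^ 2 := by gcongr
      _ = ε ^ (1 / 4 : ℝ) := by
        rw [← Real.rpow_mul_natCast hε.le, ← Real.rpow_add hε]; norm_num
  have hb1 : 124416 * c₁ ^ 2 * (n * ε ^ 2 * (m * (ε ^ (7 / 16 : ℝ)) ^ 2) ^ 3) ≤ 1 / 8 := by
    refine (mul_le_mul_of_nonneg_left ?_ (by positivity)).trans h8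
    calc n * ε ^ 2 * (m * (ε ^ (7 / 16 : ℝ)) ^ 2) ^ 3
        ≤ ε ^ (-(5 / 2) : ℝ) * ε ^ 2 * (ε ^ (1 / 4 : ℝ)) ^ 3 := by gcongr
      _ = ε ^ (1 / 4 : ℝ) := by
        rw [← Real.rpow_mul_natCast hε.le, ← Real.rpow_natCast ε 2, ← Real.rpow_add hε,
          ← Real.rpow_add hε]
        norm_num
  have hb2 : 2304 * c₁ ^ 2 * (ε ^ 2 * (n / (m + 1))) ≤ 1 / 8 := by
    refine (mul_le_mul_of_nonneg_left ?_ (by positivity)).trans h9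
    calc ε ^ 2 * (n / (m + 1)) ≤ ε ^ 2 * (ε ^ (-(5 / 2) : ℝ) / ε ^ (-(5 / 8) : ℝ)) := by gcongr
      _ = ε ^ (1 / 8 : ℝ) := by
        rw [← Real.rpow_sub hε, ← Real.rpow_natCast ε 2, ← Real.rpow_add hε]
        norm_num
  obtain ⟨μ, hμ, hle⟩ := exists_expectedSamples_ge hc₁ hc₂.le hε (by positivity) h2 h3 h4 h5 h6
    (hmw.trans h7) hb1 hb2 π hπ
  refine ⟨μ, hμ, le_trans (ENNReal.ofReal_le_ofReal ?_) hle⟩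
  have : ε ^ (-(5 / 2) + θ) ≤ ε ^ (-(5 / 2) : ℝ) :=
    Real.rpow_le_rpow_of_exponent_ge hε h1 (by linarith)
  linarith
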